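/- Let $V\subset\mathbb R^2$ be an open neighbourhood of the origin and let $Z^{\pm}=(X^{\pm},Y^{\pm})$ be $C^\infty$ vector fields on $V$. Consider the Filippov vector field $Z$ equal to $Z^+$ for $y>0$ and to $Z^-$ for $y<0$, with discontinuity line $\Sigma=\{y=0\}$; put $h(x,y)=y$, and for a vector field $F$ put $Fh=\langle\nabla h,F\rangle$, $F^{n}h=F(F^{n-1}h)$. Assume that the origin is a $(2k^+,2k^-)$-tangential center of $Z$ (with $k^\pm\ge 1$), that is: * $(Z^{\pm})^i h(0,0)=0$ for $1\le i<2k^\pm$, $(Z^+)^{2k^+}h(0,0)<0$ and $(Z^-)^{2k^-}h(0,0)>0$ (invisible contacts of multiplicity $2k^\pm$ with $\Sigma$); * $Z$ has a first-return map on $\Sigma$ around the origin: for every small $x\neq0$ the trajectory from $(x,0)$ runs through one open half plane, crosses $\Sigma$, runs through the other one and meets $\Sigma$ again; * near the origin this first-return map is the identity. Let $\varphi$ be the half-return map: $\varphi(0)=0$, and for small $x\ne0$ the points $(x,0)$ and $(\varphi(x),0)$ are joined, forwards or backwards in time, by a trajectory of $Z^+$ in $\{y>0\}$ (equivalently, for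 a center, of $Z^-$ in $\{y<0\}$). Let $\delta=\operatorname{sign}X^+(0,0)$, $\eta^{\pm}=\pm\delta\,Y^{\pm}/X^{\pm}$, and for $(t,x)$ near $(0,0)$ let $t\mapsto y^{\pm}(t,x)$ be the solution of $$\frac{dy}{dt}=\eta^{\pm}(x\pm\delta t,\,y),\qquad y(0)=0 .$$ Let $T$ be the period function $T(x)=\delta\,(T^-(x)-T^+(x))$, where $$T^{\pm}(x)=(\varphi(x)-x)\int_0^1\frac{dt}{X^{\pm}\big(x+(\varphi(x)-x)t,\;y^{\pm}(\pm\delta(\varphi(x)-x)t,\,x)\big)} .$$ Then $T(0)=0$, $T$ is differentiable at $0$, and $$T'(0)=2\delta\,\frac{X^-(0,0)-X^+(0,0)}{X^+(0,0)\,X^-(0,0)}>0 .$$ Moreover there is $\varepsilon>0$ such that for every $x\in(0,\varepsilon)$ the number $T(x)$ is the time that the trajectory of $Z$ starting at $(x,0)$ takes for its first return to $(x,0)$, $T$ is differentiable at $x$, and $T'(x)\neq0$; that is, there are no critical periods near the center. -/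

import Mathlib

open Set Filter Topology
open scoped ContDiff

noncomputable section

namespace Filippov

/-- The iterated derivatives `F^n h` of a function `h` along a planar vector field `F`:
`F^0 h = h` and `F^(n+1) h (p) = ⟨∇(F^n h)(p), F p⟩`. -/
def lieIter (F : ℝ × ℝ → ℝ × ℝ) (h : ℝ × ℝ → ℝ) : ℕ → ℝ × ℝ → ℝ
  | 0 => h
  | n + 1 => fun p => fderiv ℝ (lieIter F h n) p (F p)

/-- The point `p` of `Σ = h⁻¹(0)` is a contact of multiplicity `k` between `F` and `Σ`.
(There is no contact of multiplicity `0`.) -/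
def IsContact (F : ℝ × ℝ → ℝ × ℝ) (h : ℝ × ℝ → ℝ) (p : ℝ × ℝ) (k : ℕ) : Prop :=
  h p = 0 ∧ (∀ i, 1 ≤ i → i < k → lieIter F h i p = 0) ∧ lieIter F h k p ≠ 0

/-- The part of `V` above the line `Σ = {y = 0}`. -/
def upper (V : Set (ℝ × ℝ)) : Set (ℝ × ℝ) := {p | p ∈ V ∧ 0 < p.2}

/-- The part of `V` below the line `Σ = {y = 0}`. -/
def lower (V : Set (ℝ × ℝ)) : Set (ℝ × ℝ) := {p | p ∈ V ∧ p.2 < 0}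

/-- Forward in time, the vector field `F` has a trajectory which leaves `(a, 0)` at time `0`,
arrives at `(b, 0)` at time `τ > 0`, and lies in `S` at all times strictly in between.
It is used with `S = upper V` and `S = lower V`, so that `τ` is the first time after `0`
at which the trajectory meets `Σ = {y = 0}`. -/
def IsArc (F : ℝ × ℝ → ℝ × ℝ) (S : Set (ℝ × ℝ)) (a b τ : ℝ) : Prop :=
  0 < τ ∧ ∃ γ : ℝ → ℝ × ℝ,
    γ 0 = (a, 0) ∧ γ τ = (b, 0) ∧ (∀ t ∈ Ioo 0 τ, γ t ∈ S) ∧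
    ∀ t ∈ Icc 0 τ, HasDerivWithinAt γ (F (γ t)) (Icc 0 τ) t

/-- The trajectory of the Filippov vector field `Z` (equal to `Zp` in `y > 0` and to `Zm` in
`y < 0`) starting at `(x, 0)` travels through one of the two open half planes, crosses
`Σ = {y = 0}`, travels through the other half plane, and then meets `Σ` at `(x', 0)`,
the whole tour taking time `T`. -/
def IsFirstReturn (Zp Zm : ℝ × ℝ → ℝ × ℝ) (V : Set (ℝ × ℝ)) (x x' T : ℝ) : Prop :=
  ∃ b τ₁ τ₂ : ℝ, T = τ₁ + τ₂ ∧
    ((IsArc Zp (upper V) x b τ₁ ∧ IsArc Zm (lower V) b x' τ₂) ∨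
     (IsArc Zm (lower V) x b τ₁ ∧ IsArc Zp (upper V) b x' τ₂))

/-- The origin is a `(2 kp, 2 km)`-monodromic tangential singularity of `Z = (Zp, Zm)`, with
discontinuity line `y = 0`: an invisible contact of multiplicity `2 kp` for `Zp` and of
multiplicity `2 km` for `Zm`, around which a first-return map is defined. -/
structure IsMonodromicTangential (Zp Zm : ℝ × ℝ → ℝ × ℝ) (V : Set (ℝ × ℝ)) (kp km : ℕ) :
    Prop where
  contact_plus : IsContact Zp Prod.snd (0, 0) (2 * kp)
  contact_minus : IsContact Zm Prod.snd (0, 0) (2 * km)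
  invisible_plus : lieIter Zp Prod.snd (2 * kp) (0, 0) < 0
  invisible_minus : 0 < lieIter Zm Prod.snd (2 * km) (0, 0)
  return_map : ∀ᶠ x in 𝓝[≠] (0 : ℝ), ∃ x' T, IsFirstReturn Zp Zm V x x' T

/-- The origin is a `(2 kp, 2 km)`-tangential center of `Z = (Zp, Zm)`: a monodromic tangential
singularity near which the first-return map is the identity. -/
structure IsTangentialCenter (Zp Zm : ℝ × ℝ → ℝ × ℝ) (V : Set (ℝ × ℝ)) (kp km : ℕ) :
    Prop extends IsMonodromicTangential Zp Zm V kp km where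
  return_eq : ∀ᶠ x in 𝓝[≠] (0 : ℝ), ∀ x' T, IsFirstReturn Zp Zm V x x' T → x' = x

/-- `φ` is, near `0`, the half-return map on `Σ = {y = 0}` defined by the flow of `F` in `S`
(a half plane): it fixes `0`, and for small `x ≠ 0` the points `(x, 0)` and `(φ x, 0)` are
joined by a trajectory of `F` in `S`, run forwards or backwards in time. -/
def IsHalfReturnMap (F : ℝ × ℝ → ℝ × ℝ) (S : Set (ℝ × ℝ)) (φ : ℝ → ℝ) : Prop :=
  φ 0 = 0 ∧ ∀ᶠ x in 𝓝[≠] (0 : ℝ), ∃ τ, IsArc F S x (φ x) τ ∨ IsArc F S (φ x) x τ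

/-- `δ = sign X⁺(0, 0)`. -/
def delta (Zp : ℝ × ℝ → ℝ × ℝ) : ℝ := Real.sign (Zp (0, 0)).1

/-- `η = c Y / X` for `F = (X, Y)`; here `c = δ` for `Z⁺` and `c = -δ` for `Z⁻`. -/
def eta (F : ℝ × ℝ → ℝ × ℝ) (c : ℝ) (p : ℝ × ℝ) : ℝ := c * (F p).2 / (F p).1

/-- For `x` near `0`, the function `t ↦ y t x` is, for `t` near `0` (uniformly in `x`), the
solution of `dy/dt = η (x + c t, y)`, `y(0) = 0`, in the part of `V` where `X ≠ 0`. -/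
def IsIVPSolution (F : ℝ × ℝ → ℝ × ℝ) (V : Set (ℝ × ℝ)) (c : ℝ) (y : ℝ → ℝ → ℝ) : Prop :=
  ∃ r > 0, ∀ x, |x| < r → y 0 x = 0 ∧ ∀ t, |t| < r →
    (x + c * t, y t x) ∈ V ∧ (F (x + c * t, y t x)).1 ≠ 0 ∧
    HasDerivAt (fun s => y s x) (eta F c (x + c * t, y t x)) t

/-- `(φ(x) - x) ∫₀¹ dt / X (x + (φ(x) - x) t, y (c (φ(x) - x) t, x))`, the (signed) half-period
function `T⁺` (for `c = δ`) or `T⁻` (for `c = -δ`). -/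
def halfPeriod (F : ℝ × ℝ → ℝ × ℝ) (c : ℝ) (φ : ℝ → ℝ) (y : ℝ → ℝ → ℝ) (x : ℝ) : ℝ :=
  (φ x - x) * ∫ t in (0 : ℝ)..1, 1 / (F (x + (φ x - x) * t, y (c * (φ x - x) * t) x)).1

/-- The period function `T = δ (T⁻ - T⁺)`. -/
def periodFunction (Zp Zm : ℝ × ℝ → ℝ × ℝ) (φ : ℝ → ℝ) (yp ym : ℝ → ℝ → ℝ) (x : ℝ) : ℝ :=
  delta Zp * (halfPeriod Zm (-delta Zp) φ ym x - halfPeriod Zp (delta Zp) φ yp x)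

/-- A critical period of `T`: a point `ρ > 0` where `T` has derivative zero. -/
def IsCriticalPeriod (T : ℝ → ℝ) (ρ : ℝ) : Prop := 0 < ρ ∧ deriv T ρ = 0

end Filippov

end

noncomputable section

namespace Filippov

/-! ### Calculus on the line -/

/-! A contact of multiplicity at least 2 forces `X ≠ 0` at the origin, since otherwise the field
vanishes there and so do all its Lie derivatives. Hence orbits near the origin are graphs `s ↦ Y s
x` of solutions of `dy/ds = Y/X`, and flight times along them are integrals of `1/X`.

Let `g x = Y 0 x` be the height at which the orbit of `(x, 0)` meets the vertical axis. Two points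
of `Σ` on one orbit have the same height, so `g (φ x) = g x`. An even contact makes `g` comparable
to an even power of `x` and `g'` to the odd power below it (`exists_contact_asymptotics`). As `φ`
changes sides, `φ x / x → -1`, and implicit differentiation gives `φ' → -1` (`tendsto_div_neg_one`,
`exists_deriv_tendsto_neg_one`).

The flight time from `x` to `φ x` is, up to sign, `A x - A (φ x)`, with `A` the time to the vertical
axis. Differentiable dependence on initial conditions shows that `A` is differentiable, with `A' x →
A' 0 = -1/X(0)` (`hasDerivAt_timeToAxis`, `tendsto_timeToAxisDeriv`). So both the derivative of this
difference at `0` and the limit of its derivatives are `-2/X(0)`. Combining the two half planes, `T'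
x` tends to `T' 0`, which is positive because a closed tour forces `X⁺` and `X⁻` to have opposite
signs. Therefore `T' ≠ 0` near `0`.

To apply this to actual trajectories, `arc_mem_graph` confines every arc that starts near the
contact to the graph of its orbit, with the orbit of `(-2x, 0)` as barrier. -/

theorem monotoneOn_of_hasDerivWithinAt_nonneg {D : Set ℝ} (hD : Convex ℝ D) {f f' : ℝ → ℝ}
    (hf : ∀ x ∈ D, HasDerivWithinAt f (f' x) D x) (hf' : ∀ x ∈ D, 0 ≤ f' x) : MonotoneOn f D := by
  have h : ∀ x ∈ interior D, HasDerivAt f (f' x) x := fun x hx =>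
    (hf x (interior_subset hx)).hasDerivAt (mem_interior_iff_mem_nhds.1 hx)
  refine monotoneOn_of_deriv_nonneg hD (fun x hx => (hf x hx).continuousWithinAt)
    (fun x hx => (h x hx).differentiableAt.differentiableWithinAt) fun x hx => ?_
  rw [(h x hx).deriv]
  exact hf' x (interior_subset hx)

/-- A two-sided Grönwall inequality for a scalar function. -/
theorem abs_le_abs_mul_exp_of_abs_deriv_le {I : Set ℝ} (hI : Convex ℝ I) {W W' : ℝ → ℝ} {K : ℝ}
    (hW : ∀ s ∈ I, HasDerivWithinAt W (W' s) I s) (hK : ∀ s ∈ I, |W' s| ≤ K * |W s|)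
    {s t : ℝ} (hs : s ∈ I) (ht : t ∈ I) : |W s| ≤ |W t| * Real.exp (K * |s - t|) := by
  have key : ∀ u ∈ I, |W u * W' u| ≤ K * W u ^ 2 := fun u hu => by
    rw [abs_mul, ← sq_abs (W u)]
    nlinarith [hK u hu, abs_nonneg (W u)]
  have exp_deriv : ∀ c u : ℝ, HasDerivWithinAt (fun v => Real.exp (c * v)) (Real.exp (c * u) * c) I u :=
    fun c u => by
      simpa using (((hasDerivAt_id u).const_mul c).exp).hasDerivWithinAt
  have sq_deriv : ∀ u ∈ I, HasDerivWithinAt (fun v => W v ^ 2) (2 * (W u * W' u)) I u :=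
    fun u hu => by
      refine ((hW u hu).fun_pow 2).congr_deriv ?_
      push_cast
      ring
  -- `(W²)' = 2 W W'` lies between `-2K W²` and `2K W²`; the exponential weights turn the two bounds
  -- into monotonicity.
  have up : MonotoneOn (fun v => W v ^ 2 * Real.exp (2 * K * v)) I := by
    refine monotoneOn_of_hasDerivWithinAt_nonneg hI
      (fun u hu => (sq_deriv u hu).mul (exp_deriv (2 * K) u)) fun u hu => ?_
    have := abs_le.1 (key u hu)
    have := Real.exp_pos (2 * K * u)
    nlinarith
  have down : MonotoneOn (fun v => -(W v ^ 2 * Real.exp (-2 * K * v))) I := by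
    refine monotoneOn_of_hasDerivWithinAt_nonneg hI
      (fun u hu => ((sq_deriv u hu).mul (exp_deriv (-2 * K) u)).neg) fun u hu => ?_
    have := abs_le.1 (key u hu)
    have := Real.exp_pos (-2 * K * u)
    nlinarith
  have hsq : W s ^ 2 ≤ W t ^ 2 * Real.exp (2 * K * |s - t|) := by
    rcases le_total s t with h | h
    · have := up hs ht h
      rw [abs_of_nonpos (sub_nonpos.2 h)]
      have e : Real.exp (2 * K * -(s - t)) = Real.exp (2 * K * t) / Real.exp (2 * K * s) := by
        rw [← Real.exp_sub]; ring_nf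
      rw [e, ← mul_div_assoc, le_div_iff₀ (Real.exp_pos _)]
      exact this
    · have := neg_le_neg_iff.1 (down ht hs h)
      rw [abs_of_nonneg (sub_nonneg.2 h)]
      have e : Real.exp (2 * K * (s - t)) = Real.exp (-2 * K * t) / Real.exp (-2 * K * s) := by
        rw [← Real.exp_sub]; ring_nf
      rw [e, ← mul_div_assoc, le_div_iff₀ (Real.exp_pos _)]
      exact this
  refine abs_le_of_sq_le_sq' ?_ (by positivity) |> abs_le.2
  refine hsq.trans_eq ?_
  rw [mul_pow, sq_abs, ← Real.exp_nat_mul]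
  push_cast
  ring_nf

/-- A function that solves a scalar linear differential inequality has constant sign. -/
theorem pos_of_abs_deriv_le {I : Set ℝ} (hI : Convex ℝ I) {W W' : ℝ → ℝ} {K : ℝ}
    (hW : ∀ s ∈ I, HasDerivWithinAt W (W' s) I s) (hK : ∀ s ∈ I, |W' s| ≤ K * |W s|)
    {s t : ℝ} (hs : s ∈ I) (ht : t ∈ I) (h : 0 < W s) : 0 < W t := by
  by_contra! hle
  have hc : ContinuousOn W I := fun u hu => (hW u hu).continuousWithinAt
  obtain ⟨u, hu, hu0⟩ := hI.isPreconnected.intermediate_value ht hs hc ⟨hle, h.le⟩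
  have := abs_le_abs_mul_exp_of_abs_deriv_le hI hW hK hs hu
  rw [hu0, abs_zero, zero_mul] at this
  exact h.ne' (abs_nonpos_iff.1 this)

/-- L'Hôpital's rule. Iterated along an orbit, it turns the first nonzero Lie derivative at a
contact into a leading coefficient. -/
theorem tendsto_div_pow_succ_of_deriv {u u' : ℝ → ℝ} {L : ℝ} {n : ℕ}
    (hu : ∀ᶠ s in 𝓝 (0 : ℝ), HasDerivAt u (u' s) s) (h0 : u 0 = 0)
    (hL : Tendsto (fun s => u' s / s ^ n) (𝓝[≠] 0) (𝓝 L)) :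
    Tendsto (fun s => u s / s ^ (n + 1)) (𝓝[≠] 0) (𝓝 (L / (n + 1))) := by
  have hn : ((n : ℝ) + 1) ≠ 0 := by positivity
  refine HasDerivAt.lhopital_zero_nhdsNE (f' := u') (g' := fun s => ((n : ℝ) + 1) * s ^ n)
    (hu.filter_mono nhdsWithin_le_nhds) (.of_forall fun s => ?_) ?_ ?_ ?_ ?_
  · simpa using hasDerivAt_pow (n + 1) s
  · filter_upwards [self_mem_nhdsWithin] with s hs
    exact mul_ne_zero hn (pow_ne_zero _ hs)
  · have := hu.self_of_nhds.continuousAt.tendsto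
    rw [h0] at this
    exact this.mono_left nhdsWithin_le_nhds
  · have : Tendsto (fun s : ℝ => s ^ (n + 1)) (𝓝 0) (𝓝 (0 ^ (n + 1))) :=
      (continuous_pow (n + 1)).tendsto 0
    rw [zero_pow (Nat.succ_ne_zero n)] at this
    exact this.mono_left nhdsWithin_le_nhds
  · refine (hL.div_const ((n : ℝ) + 1)).congr fun s => ?_
    rw [div_div, mul_comm]

theorem hasDerivAt_of_abs_sub_le_sq {F : ℝ → ℝ} {D C x : ℝ}
    (h : ∀ᶠ y in 𝓝 x, |F y - F x - (y - x) * D| ≤ C * (y - x) ^ 2) : HasDerivAt F D x := by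
  rw [hasDerivAt_iff_isLittleO]
  have h1 : (fun y => F y - F x - (y - x) • D) =O[𝓝 x] fun y => ‖y - x‖ ^ 2 := by
    refine Asymptotics.IsBigO.of_bound C ?_
    filter_upwards [h] with y hy
    simpa using hy
  exact h1.trans_isLittleO (Asymptotics.isLittleO_pow_sub_sub x one_lt_two)

/-- Differentiation of a function defined implicitly by `g ∘ φ = k`. -/
theorem HasDerivAt.of_comp_left {g φ : ℝ → ℝ} {g' d x : ℝ} (hg : HasDerivAt g g' (φ x))
    (hg' : g' ≠ 0) (hφ : ContinuousAt φ x) (hd : HasDerivAt (fun y => g (φ y)) d x) :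
    HasDerivAt φ (d / g') x := by
  -- The continuous extension of the difference quotient of `g` needs no separate case for `φ y = φ
  -- x`.
  have hc : ContinuousAt (dslope g (φ x)) (φ x) :=
    continuousAt_dslope_same.2 hg.differentiableAt
  have hv : dslope g (φ x) (φ x) = g' := by rw [dslope_same, hg.deriv]
  have ht : Tendsto (fun y => dslope g (φ x) (φ y)) (𝓝 x) (𝓝 g') := by
    have := hc.tendsto.comp hφ.tendsto
    rwa [hv] at this
  rw [hasDerivAt_iff_tendsto_slope] at hd ⊢
  refine (hd.div (ht.mono_left nhdsWithin_le_nhds) hg').congr' ?_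
  filter_upwards [nhdsWithin_le_nhds (ht.eventually_ne hg')] with y hy
  rw [Pi.div_apply, div_eq_iff hy, slope_def_field, slope_def_field, ← sub_smul_dslope g (φ x) (φ y), smul_eq_mul]
  ring

theorem hasDerivAt_integral_Ioo {h : ℝ → ℝ} {r a s : ℝ} (hh : ContinuousOn h (Ioo (-r) r))
    (ha : a ∈ Ioo (-r) r) (hs : s ∈ Ioo (-r) r) :
    HasDerivAt (fun s => ∫ u in a..s, h u) (h s) s := by
  have hsub : uIcc a s ⊆ Ioo (-r) r := ordConnected_Ioo.uIcc_subset ha hs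
  exact intervalIntegral.integral_hasDerivAt_right (hh.mono hsub).intervalIntegrable
    (hh.stronglyMeasurableAtFilter isOpen_Ioo s hs) (hh.continuousAt (isOpen_Ioo.mem_nhds hs))

/-! ### The orbits of a planar field as graphs -/

/-- The partial derivative in the second variable. -/
def partialY (u : ℝ × ℝ → ℝ) (p : ℝ × ℝ) : ℝ := fderiv ℝ u p (0, 1)

/-- `u` and `∂u/∂y` are bounded and Lipschitz on the square of half side `R` at the origin. -/
structure RegularOn (u : ℝ × ℝ → ℝ) (K R : ℝ) : Prop where
  bound : ∀ p ∈ Metric.ball (0 : ℝ × ℝ) R, |u p| ≤ K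
  lip : ∀ p ∈ Metric.ball (0 : ℝ × ℝ) R, ∀ q ∈ Metric.ball (0 : ℝ × ℝ) R, |u p - u q| ≤ K * ‖p - q‖
  deriv : ∀ p ∈ Metric.ball (0 : ℝ × ℝ) R, HasDerivAt (fun y => u (p.1, y)) (partialY u p) p.2
  partial_bound : ∀ p ∈ Metric.ball (0 : ℝ × ℝ) R, |partialY u p| ≤ K
  partial_lip : ∀ p ∈ Metric.ball (0 : ℝ × ℝ) R, ∀ q ∈ Metric.ball (0 : ℝ × ℝ) R,
    |partialY u p - partialY u q| ≤ K * ‖p - q‖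

theorem RegularOn.mono {u : ℝ × ℝ → ℝ} {K K' R R' : ℝ} (h : RegularOn u K R) (hK : K ≤ K')
    (hR : R' ≤ R) : RegularOn u K' R' := by
  have hs := Metric.ball_subset_ball (x := (0 : ℝ × ℝ)) hR
  exact
    { bound := fun p hp => (h.bound p (hs hp)).trans hK
      lip := fun p hp q hq => (h.lip p (hs hp) q (hs hq)).trans (by gcongr)
      deriv := fun p hp => h.deriv p (hs hp)
      partial_bound := fun p hp => (h.partial_bound p (hs hp)).trans hK
      partial_lip := fun p hp q hq => (h.partial_lip p (hs hp) q (hs hq)).trans (by gcongr) }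

/-- One constant serves all small `R`, so the estimates for several functions can be imposed on a
common square. -/
theorem exists_bound_lipschitz {u : ℝ × ℝ → ℝ} (hu : ContDiffAt ℝ 1 u 0) :
    ∃ K : ℝ, ∀ᶠ R in 𝓝[>] (0 : ℝ), (∀ p ∈ Metric.ball (0 : ℝ × ℝ) R, |u p| ≤ K) ∧
      ∀ p ∈ Metric.ball (0 : ℝ × ℝ) R, ∀ q ∈ Metric.ball (0 : ℝ × ℝ) R,
        |u p - u q| ≤ K * ‖p - q‖ := by
  obtain ⟨L, t, ht, hL⟩ := hu.exists_lipschitzOnWith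
  have hb : ∀ᶠ p in 𝓝 (0 : ℝ × ℝ), |u p| < |u 0| + 1 :=
    hu.continuousAt.abs.eventually_lt_const (lt_add_one _)
  obtain ⟨R, hR, hball⟩ := Metric.mem_nhds_iff.1 (inter_mem ht hb)
  refine ⟨max L (|u 0| + 1), ?_⟩
  filter_upwards [Ioo_mem_nhdsGT hR] with R' hR'
  have hs := (Metric.ball_subset_ball hR'.2.le).trans hball
  refine ⟨fun p hp => (hs hp).2.le.trans (le_max_right _ _), fun p hp q hq => ?_⟩
  have := hL.dist_le_mul p (hs hp).1 q (hs hq).1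
  rw [Real.dist_eq, dist_eq_norm] at this
  refine this.trans ?_
  gcongr
  exact le_max_left _ _

theorem exists_regularOn {u : ℝ × ℝ → ℝ} (hu : ContDiffAt ℝ 2 u 0) :
    ∃ K : ℝ, ∀ᶠ R in 𝓝[>] (0 : ℝ), RegularOn u K R := by
  have hd : ContDiffAt ℝ 1 (partialY u) 0 :=
    ((hu.fderiv_right (m := 1) (by norm_num)).clm_apply contDiffAt_const)
  obtain ⟨K₁, h₁⟩ := exists_bound_lipschitz (hu.of_le one_le_two)
  obtain ⟨K₂, h₂⟩ := exists_bound_lipschitz hd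
  have hdiff : ∀ᶠ p in 𝓝 (0 : ℝ × ℝ), DifferentiableAt ℝ u p :=
    (hu.eventually (by simp)).mono fun p hp => hp.differentiableAt (by simp)
  obtain ⟨R, hR, hball⟩ := Metric.mem_nhds_iff.1 hdiff
  refine ⟨max K₁ K₂, ?_⟩
  filter_upwards [h₁, h₂, Ioo_mem_nhdsGT hR] with R' h₁' h₂' hR'
  have hs := (Metric.ball_subset_ball hR'.2.le).trans hball
  exact
    { bound := fun p hp => (h₁'.1 p hp).trans (le_max_left _ _)
      lip := fun p hp q hq => (h₁'.2 p hp q hq).trans (by gcongr; exact le_max_left _ _)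
      deriv := fun p hp => by
        have hl : HasDerivAt (fun y : ℝ => (p.1, y)) ((0 : ℝ), (1 : ℝ)) p.2 :=
          (hasDerivAt_const _ _).prodMk (hasDerivAt_id _)
        have hp' : DifferentiableAt ℝ u p := hs hp
        exact hp'.hasFDerivAt.comp_hasDerivAt p.2 hl
      partial_bound := fun p hp => (h₂'.1 p hp).trans (le_max_right _ _)
      partial_lip := fun p hp q hq => (h₂'.2 p hp q hq).trans (by gcongr; exact le_max_right _ _) }

theorem mem_ball_prod {a b R : ℝ} :
    (a, b) ∈ Metric.ball (0 : ℝ × ℝ) R ↔ |a| < R ∧ |b| < R := by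
  simp [Prod.norm_def]

section RegularOn

variable {u : ℝ × ℝ → ℝ} {K R s y z : ℝ}

theorem RegularOn.nonneg (h : RegularOn u K R) (hR : 0 < R) : 0 ≤ K :=
  (abs_nonneg _).trans (h.bound 0 (Metric.mem_ball_self hR))

theorem RegularOn.continuousOn (h : RegularOn u K R) (hR : 0 < R) :
    ContinuousOn u (Metric.ball 0 R) :=
  (LipschitzOnWith.of_dist_le_mul (K := ⟨K, h.nonneg hR⟩) fun p hp q hq => by
    rw [dist_eq_norm, dist_eq_norm]; exact h.lip p hp q hq).continuousOn

theorem RegularOn.continuousOn_partialY (h : RegularOn u K R) (hR : 0 < R) :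
    ContinuousOn (partialY u) (Metric.ball 0 R) :=
  (LipschitzOnWith.of_dist_le_mul (K := ⟨K, h.nonneg hR⟩) fun p hp q hq => by
    rw [dist_eq_norm, dist_eq_norm]; exact h.partial_lip p hp q hq).continuousOn

theorem RegularOn.abs_sub_le (h : RegularOn u K R) (hy : (s, y) ∈ Metric.ball (0 : ℝ × ℝ) R)
    (hz : (s, z) ∈ Metric.ball (0 : ℝ × ℝ) R) : |u (s, z) - u (s, y)| ≤ K * |z - y| := by
  simpa [Prod.norm_def] using h.lip _ hz _ hy

/-- The mean value inequality for `w ↦ u (s, w) - ∂u/∂y (s, y) w`, whose derivative is small because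
`∂u/∂y` is Lipschitz. -/
theorem RegularOn.abs_taylor_le (h : RegularOn u K R) (hR : 0 < R)
    (hy : (s, y) ∈ Metric.ball (0 : ℝ × ℝ) R) (hz : (s, z) ∈ Metric.ball (0 : ℝ × ℝ) R) :
    |u (s, z) - u (s, y) - partialY u (s, y) * (z - y)| ≤ K * |z - y| ^ 2 := by
  have hK := h.nonneg hR
  have hmem : ∀ w ∈ uIcc y z, (s, w) ∈ Metric.ball (0 : ℝ × ℝ) R := fun w hw => by
    rw [mem_ball_prod] at hy hz ⊢
    rw [abs_lt] at hy hz ⊢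
    refine ⟨hy.1, abs_lt.2 ?_⟩
    rcases mem_uIcc.1 hw with ⟨h1, h2⟩ | ⟨h1, h2⟩ <;> have := abs_lt.1 hy.2 <;>
      have := abs_lt.1 hz.2 <;> constructor <;> linarith
  have hd : ∀ w ∈ uIcc y z, HasDerivWithinAt (fun w => u (s, w) - partialY u (s, y) * w)
      (partialY u (s, w) - partialY u (s, y)) (uIcc y z) w := fun w hw => by
    simpa using ((h.deriv _ (hmem w hw)).fun_sub
      ((hasDerivAt_id' w).const_mul (partialY u (s, y)))).hasDerivWithinAt
  have hb : ∀ w ∈ uIcc y z, ‖partialY u (s, w) - partialY u (s, y)‖ ≤ K * |z - y| := fun w hw => by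
    refine (h.partial_lip _ (hmem w hw) _ hy).trans ?_
    have : |w - y| ≤ |z - y| := abs_sub_left_of_mem_uIcc hw
    simpa [Prod.norm_def] using mul_le_mul_of_nonneg_left this hK
  have := (convex_uIcc y z).norm_image_sub_le_of_norm_hasDerivWithin_le hd hb left_mem_uIcc
    right_mem_uIcc
  rw [Real.norm_eq_abs, Real.norm_eq_abs] at this
  calc _ = |u (s, z) - partialY u (s, y) * z - (u (s, y) - partialY u (s, y) * y)| := by
        congr 1; ring
    _ ≤ _ := this
    _ = _ := by ring

end RegularOn

/-- A bootstrap: the bound on `y'` is available only inside the cone `|y| ≤ K|t|`, and being strict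
it prevents `y` from leaving the cone. Negative times follow by reflection. -/
theorem abs_le_of_abs_deriv_lt {y y' : ℝ → ℝ} {r K : ℝ} (h0 : y 0 = 0)
    (hy : ∀ t, |t| < r → HasDerivAt y (y' t) t)
    (hK : ∀ t, |t| < r → |y t| ≤ K * |t| → |y' t| < K) {t : ℝ} (ht : |t| < r) :
    |y t| ≤ K * |t| := by
  have main : ∀ (z z' : ℝ → ℝ), z 0 = 0 → (∀ t, |t| < r → HasDerivAt z (z' t) t) →
      (∀ t, |t| < r → |z t| ≤ K * |t| → |z' t| < K) → ∀ t, 0 ≤ t → |t| < r → |z t| ≤ K * |t| := by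
    intro z z' z0 hz hzK t ht0 ht
    have hlt : ∀ u ∈ Icc 0 t, |u| < r := fun u hu =>
      (abs_le_abs_of_nonneg hu.1 hu.2).trans_lt ht
    have := image_norm_le_of_norm_deriv_right_lt_deriv_boundary (f := z) (f' := z') (a := 0) (b := t)
      (B := fun u => K * u) (B' := fun _ => K)
      (fun u hu => (hz u (hlt u hu)).continuousAt.continuousWithinAt)
      (fun u hu => (hz u (hlt u (Ico_subset_Icc_self hu))).hasDerivWithinAt) (by simp [z0])
      (fun u => by simpa using (hasDerivAt_id u).const_mul K)
      (fun u hu h => hzK u (hlt u (Ico_subset_Icc_self hu))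
        (by rw [abs_of_nonneg hu.1]; exact h.le)) (right_mem_Icc.2 ht0)
    rwa [abs_of_nonneg ht0]
  rcases le_total 0 t with h | h
  · exact main y y' h0 hy hK t h ht
  · have := main (fun t => y (-t)) (fun t => -y' (-t)) (by simpa using h0)
      (fun t ht => by
        have := (hy (-t) (by rwa [abs_neg])).scomp t (hasDerivAt_neg t)
        simpa [Function.comp_def] using this)
      (fun t ht hb => by
        rw [abs_neg]
        exact hK (-t) (by rwa [abs_neg]) (by rwa [abs_neg]))
      (-t) (by linarith) (by rwa [abs_neg])
    simpa using this

/-- The slope `dy/dx` of the orbits of `F`. -/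
def orbitSlope (F : ℝ × ℝ → ℝ × ℝ) (p : ℝ × ℝ) : ℝ := (F p).2 / (F p).1

/-- The reciprocal of the horizontal speed of `F`. -/
def slowness (F : ℝ × ℝ → ℝ × ℝ) (p : ℝ × ℝ) : ℝ := 1 / (F p).1

/-- On `|s|, |x| < r`, the graph of `s ↦ Y s x` is the orbit of `F` through `(x, 0)`, inside a
square of half side `R` on which `F` is transverse to the vertical direction. -/
structure IsGraphFlow (F : ℝ × ℝ → ℝ × ℝ) (Y : ℝ → ℝ → ℝ) (K R r : ℝ) : Prop where
  one_le : 1 ≤ K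
  pos : 0 < r
  le_one : r ≤ 1
  le : r ≤ R
  regular_slope : RegularOn (orbitSlope F) K R
  regular_slowness : RegularOn (slowness F) K R
  speed_le : ∀ p ∈ Metric.ball (0 : ℝ × ℝ) R, |(F p).1| ≤ K
  speed_pos : ∀ p ∈ Metric.ball (0 : ℝ × ℝ) R, 0 < (F 0).1 * (F p).1
  start : ∀ x, |x| < r → Y x x = 0
  deriv : ∀ x, |x| < r → ∀ s, |s| < r →
    HasDerivAt (fun s => Y s x) (orbitSlope F (s, Y s x)) s
  bound : ∀ x, |x| < r → ∀ s, |s| < r → |Y s x| ≤ K * |s - x|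
  mem : ∀ x, |x| < r → ∀ s, |s| < r → (s, Y s x) ∈ Metric.ball (0 : ℝ × ℝ) R

/-- The abscissa `s = x + c t` replaces the time `t`; since `c² = 1`, the factor `c` in `eta`
cancels and the equation becomes `dy/ds = Y/X` for either sign of `c`. -/
theorem exists_isGraphFlow {F : ℝ × ℝ → ℝ × ℝ} {V : Set (ℝ × ℝ)} {c : ℝ} {y : ℝ → ℝ → ℝ}
    (hF : ContDiffAt ℝ 2 F 0) (hX : (F 0).1 ≠ 0) (hc : c * c = 1) (hy : IsIVPSolution F V c y) :
    ∃ K R r, IsGraphFlow F (fun s x => y (c * (s - x)) x) K R r := by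
  have hX' : ContDiffAt ℝ 2 (fun p => (F p).1) 0 := contDiff_fst.contDiffAt.comp _ hF
  have hY' : ContDiffAt ℝ 2 (fun p => (F p).2) 0 := contDiff_snd.contDiffAt.comp _ hF
  obtain ⟨K₁, h₁⟩ := exists_regularOn (u := orbitSlope F) (hY'.div hX' hX)
  obtain ⟨K₂, h₂⟩ := exists_regularOn (u := slowness F) (contDiffAt_const.div hX' hX)
  obtain ⟨K₃, h₃⟩ := exists_regularOn hX'
  have hs : ∀ᶠ R in 𝓝[>] (0 : ℝ), ∀ p ∈ Metric.ball (0 : ℝ × ℝ) R, 0 < (F 0).1 * (F p).1 := by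
    have h : ∀ᶠ p in 𝓝 (0 : ℝ × ℝ), 0 < (F 0).1 * (F p).1 :=
      (continuousAt_const.mul hX'.continuousAt).eventually_const_lt (mul_self_pos.2 hX)
    obtain ⟨R, hR, hball⟩ := Metric.mem_nhds_iff.1 h
    filter_upwards [Ioo_mem_nhdsGT hR] with R' hR' p hp
    exact hball (Metric.ball_subset_ball hR'.2.le hp)
  obtain ⟨R, hR₁, hR₂, hR₃, hRs, hR⟩ :=
    (h₁.and (h₂.and (h₃.and (hs.and self_mem_nhdsWithin)))).exists
  replace hR : 0 < R := hR
  -- The added `1` makes the bound on the slope strict, as the bootstrap requires, and gives `1 ≤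
  -- K`.
  set K := max (max K₁ K₂) (max K₃ 0) + 1 with hK
  have hK₁ : K₁ < K := by rw [hK]; linarith [le_max_left K₁ K₂, le_max_left (max K₁ K₂) (max K₃ 0)]
  have hK₂ : K₂ < K := by rw [hK]; linarith [le_max_right K₁ K₂, le_max_left (max K₁ K₂) (max K₃ 0)]
  have hK₃ : K₃ < K := by rw [hK]; linarith [le_max_left K₃ 0, le_max_right (max K₁ K₂) (max K₃ 0)]
  have hK1 : 1 ≤ K := by rw [hK]; linarith [le_max_right K₃ 0, le_max_right (max K₁ K₂) (max K₃ 0)]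
  obtain ⟨r₁, hr₁, hsol⟩ := hy
  have hcabs : ∀ t, |c * t| = |t| := fun t => by
    rw [abs_mul, (by nlinarith [abs_mul_abs_self c, abs_nonneg c] : |c| = 1), one_mul]
  -- Times `c (s - x)` reach up to `2r`: `2r < r₁` keeps them in the domain of the solution, and
  -- `4Kr < R` keeps the cone in the square.
  obtain ⟨r, hr, hrlt⟩ : ∃ r, 0 < r ∧ r < min (min 1 (r₁ / 2)) (R / (4 * K)) :=
    exists_between (by positivity)
  simp only [lt_min_iff] at hrlt
  obtain ⟨⟨hr1, hrr⟩, hrR⟩ := hrlt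
  rw [lt_div_iff₀ (by positivity)] at hrR
  have hrR' : r ≤ R := by nlinarith
  have hball : ∀ x, |x| < r → ∀ t, |t| < 2 * r → ∀ z, |z| ≤ K * |t| →
      (x + c * t, z) ∈ Metric.ball (0 : ℝ × ℝ) R := fun x hx t ht z hz => by
    rw [mem_ball_prod]
    have := abs_add_le x (c * t)
    rw [hcabs] at this
    constructor
    · nlinarith
    · nlinarith
  have hbound : ∀ x, |x| < r → ∀ t, |t| < 2 * r → |y t x| ≤ K * |t| := by
    intro x hx t ht
    obtain ⟨hx0, hxs⟩ := hsol x (by linarith)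
    refine abs_le_of_abs_deriv_lt (y := fun t => y t x) hx0
      (fun u hu => (hxs u (by linarith)).2.2) (fun u hu hb => ?_) ht
    have := hR₁.bound _ (hball x hx u hu _ hb)
    rw [eta, mul_div_assoc, hcabs]
    exact this.trans_lt hK₁
  have hdist : ∀ x, |x| < r → ∀ s, |s| < r → |c * (s - x)| < 2 * r := fun x hx s hs => by
    rw [hcabs]
    have := abs_sub s x
    linarith
  have hcc : ∀ s x, x + c * (c * (s - x)) = s := fun s x => by linear_combination (s - x) * hc
  exact ⟨K, R, r,
    { one_le := hK1
      pos := hr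
      le_one := hr1.le
      le := hrR'
      regular_slope := hR₁.mono hK₁.le le_rfl
      regular_slowness := hR₂.mono hK₂.le le_rfl
      speed_le := fun p hp => (hR₃.bound p hp).trans hK₃.le
      speed_pos := hRs
      start := fun x hx => by simpa using (hsol x (by linarith)).1
      deriv := fun x hx s hs => by
        have h := ((hsol x (by linarith)).2 (c * (s - x))
          (by linarith [hdist x hx s hs])).2.2
        rw [hcc] at h
        have := h.scomp s (((hasDerivAt_id s).sub_const x).const_mul c)
        refine this.congr_deriv ?_
        simp only [smul_eq_mul, eta, orbitSlope]
        rw [mul_one, ← mul_div_assoc, ← mul_assoc, hc, one_mul]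
      bound := fun x hx s hs => by
        simpa [hcabs] using hbound x hx _ (hdist x hx s hs)
      mem := fun x hx s hs => by
        have := hball x hx _ (hdist x hx s hs) _ (hbound x hx _ (hdist x hx s hs))
        rwa [hcc] at this }⟩

/-! ### Comparison of neighbouring orbits -/

namespace IsGraphFlow

variable {F : ℝ × ℝ → ℝ × ℝ} {Y : ℝ → ℝ → ℝ} {K R r : ℝ}

theorem pos_R (h : IsGraphFlow F Y K R r) : 0 < R := h.pos.trans_le h.le

theorem K_nonneg (h : IsGraphFlow F Y K R r) : 0 ≤ K := zero_le_one.trans h.one_le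

theorem speed_ne (h : IsGraphFlow F Y K R r) {p : ℝ × ℝ} (hp : p ∈ Metric.ball (0 : ℝ × ℝ) R) :
    (F p).1 ≠ 0 := fun h0 => by
  simpa [h0] using h.speed_pos p hp

theorem mem_axis (h : IsGraphFlow F Y K R r) {x : ℝ} (hx : |x| < r) :
    (x, (0 : ℝ)) ∈ Metric.ball (0 : ℝ × ℝ) R :=
  mem_ball_prod.2 ⟨hx.trans_le h.le, by simpa using h.pos_R⟩

theorem continuousOn_graph (h : IsGraphFlow F Y K R r) {x : ℝ} (hx : |x| < r) :
    ContinuousOn (fun s => (s, Y s x)) (Ioo (-r) r) :=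
  continuousOn_id.prodMk fun s hs => (h.deriv x hx s (abs_lt.2 hs)).continuousAt.continuousWithinAt

theorem continuousOn_comp_graph (h : IsGraphFlow F Y K R r) {x : ℝ} (hx : |x| < r)
    {u : ℝ × ℝ → ℝ} (hu : ContinuousOn u (Metric.ball 0 R)) :
    ContinuousOn (fun s => u (s, Y s x)) (Ioo (-r) r) :=
  hu.comp (h.continuousOn_graph hx) fun s hs => h.mem x hx s (abs_lt.2 hs)

theorem diff_deriv (h : IsGraphFlow F Y K R r) {x x' : ℝ} (hx : |x| < r) (hx' : |x'| < r) :
    ∀ s ∈ Ioo (-r) r, HasDerivWithinAt (fun s => Y s x' - Y s x)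
      (orbitSlope F (s, Y s x') - orbitSlope F (s, Y s x)) (Ioo (-r) r) s := fun s hs =>
  ((h.deriv x' hx' s (abs_lt.2 hs)).sub (h.deriv x hx s (abs_lt.2 hs))).hasDerivWithinAt

theorem diff_bound (h : IsGraphFlow F Y K R r) {x x' : ℝ} (hx : |x| < r) (hx' : |x'| < r) :
    ∀ s ∈ Ioo (-r) r, |orbitSlope F (s, Y s x') - orbitSlope F (s, Y s x)| ≤
      K * |Y s x' - Y s x| := fun s hs =>
  h.regular_slope.abs_sub_le (h.mem x hx s (abs_lt.2 hs)) (h.mem x' hx' s (abs_lt.2 hs))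

theorem lipschitz (h : IsGraphFlow F Y K R r) {x x' s : ℝ} (hx : |x| < r) (hx' : |x'| < r)
    (hs : |s| < r) : |Y s x' - Y s x| ≤ K * Real.exp (2 * K) * |x' - x| := by
  have h1 := abs_le_abs_mul_exp_of_abs_deriv_le (convex_Ioo _ _) (h.diff_deriv hx hx')
    (h.diff_bound hx hx') (abs_lt.1 hs) (abs_lt.1 hx')
  have h2 := h.bound x hx x' hx'
  rw [h.start x' hx', zero_sub, abs_neg] at h1
  have h3 : K * |s - x'| ≤ 2 * K := by
    have := abs_sub s x'
    nlinarith [h.le_one, h.one_le]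
  calc _ ≤ |Y x' x| * Real.exp (K * |s - x'|) := h1
    _ ≤ (K * |x' - x|) * Real.exp (2 * K) :=
        mul_le_mul h2 (Real.exp_le_exp.2 h3) (Real.exp_pos _).le
          (mul_nonneg h.K_nonneg (abs_nonneg _))
    _ = _ := by ring

/-- Two orbits that meet coincide. -/
theorem eq_of_eq (h : IsGraphFlow F Y K R r) {x x' s t : ℝ} (hx : |x| < r) (hx' : |x'| < r)
    (hs : |s| < r) (ht : |t| < r) (heq : Y t x' = Y t x) : Y s x' = Y s x := by
  have h1 := abs_le_abs_mul_exp_of_abs_deriv_le (convex_Ioo _ _) (h.diff_deriv hx hx')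
    (h.diff_bound hx hx') (abs_lt.1 hs) (abs_lt.1 ht)
  rw [heq, sub_self, abs_zero, zero_mul] at h1
  exact sub_eq_zero.1 (abs_nonpos_iff.1 h1)

theorem eq_of_zero (h : IsGraphFlow F Y K R r) {x b s : ℝ} (hx : |x| < r) (hb : |b| < r)
    (hs : |s| < r) (hz : Y b x = 0) : Y s b = Y s x :=
  h.eq_of_eq hx hb hs hb (by rw [hz, h.start b hb])

/-- Orbits keep their order. -/
theorem lt_of_lt (h : IsGraphFlow F Y K R r) {σ x x' s t : ℝ} (hx : |x| < r) (hx' : |x'| < r)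
    (hs : |s| < r) (ht : |t| < r) (hlt : σ * Y t x < σ * Y t x') : σ * Y s x < σ * Y s x' := by
  have := pos_of_abs_deriv_le (convex_Ioo (-r) r) (K := K)
    (fun u hu => (h.diff_deriv hx hx' u hu).const_mul σ)
    (fun u hu => by
      rw [abs_mul, abs_mul]
      nlinarith [h.diff_bound hx hx' u hu, abs_nonneg σ])
    (abs_lt.1 ht) (abs_lt.1 hs) (by linarith : 0 < σ * (Y t x' - Y t x))
  linarith

/-! ### Dependence on the initial condition -/

end IsGraphFlow

/-- The logarithm of the rate at which orbits near the orbit of `(x, 0)` separate. -/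
def logSeparation (F : ℝ × ℝ → ℝ × ℝ) (Y : ℝ → ℝ → ℝ) (s x : ℝ) : ℝ :=
  ∫ u in x..s, partialY (orbitSlope F) (u, Y u x)

/-- The derivative of `Y s x` in `x`. -/
def initialDeriv (F : ℝ × ℝ → ℝ × ℝ) (Y : ℝ → ℝ → ℝ) (s x : ℝ) : ℝ :=
  -orbitSlope F (x, 0) * Real.exp (logSeparation F Y s x)

/-- The time to the vertical axis along the orbit of `(x, 0)`. -/
def timeToAxis (F : ℝ × ℝ → ℝ × ℝ) (Y : ℝ → ℝ → ℝ) (x : ℝ) : ℝ :=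
  ∫ u in x..0, slowness F (u, Y u x)

/-- The derivative of `timeToAxis F Y`. -/
def timeToAxisDeriv (F : ℝ × ℝ → ℝ × ℝ) (Y : ℝ → ℝ → ℝ) (x : ℝ) : ℝ :=
  -slowness F (x, 0) + ∫ u in x..0, partialY (slowness F) (u, Y u x) * initialDeriv F Y u x

namespace IsGraphFlow

variable {F : ℝ × ℝ → ℝ × ℝ} {Y : ℝ → ℝ → ℝ} {K R r : ℝ}

theorem hasDerivAt_integral_graph (h : IsGraphFlow F Y K R r) {x s : ℝ} (hx : |x| < r)
    (hs : |s| < r) {u : ℝ × ℝ → ℝ} (hu : ContinuousOn u (Metric.ball 0 R)) :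
    HasDerivAt (fun s => ∫ v in x..s, u (v, Y v x)) (u (s, Y s x)) s :=
  hasDerivAt_integral_Ioo (h.continuousOn_comp_graph hx hu) (abs_lt.1 hx) (abs_lt.1 hs)

theorem abs_logSeparation_le (h : IsGraphFlow F Y K R r) {x s : ℝ} (hx : |x| < r)
    (hs : |s| < r) : |logSeparation F Y s x| ≤ K * |s - x| := by
  refine intervalIntegral.norm_integral_le_of_norm_le_const (E := ℝ) fun u hu => ?_
  have hu' : u ∈ Ioo (-r) r :=
    ordConnected_Ioo.uIcc_subset (abs_lt.1 hx) (abs_lt.1 hs) (uIoc_subset_uIcc hu)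
  exact h.regular_slope.partial_bound _ (h.mem x hx u (abs_lt.2 hu'))

theorem abs_logSeparation_le' (h : IsGraphFlow F Y K R r) {x s : ℝ} (hx : |x| < r)
    (hs : |s| < r) : |logSeparation F Y s x| ≤ 2 * K := by
  refine (h.abs_logSeparation_le hx hs).trans ?_
  have := abs_sub s x
  nlinarith [h.le_one, h.one_le]

/-- Near its initial point, an orbit is its tangent line up to a quadratic error. -/
theorem abs_integral_sub_le (h : IsGraphFlow F Y K R r) {u : ℝ × ℝ → ℝ} (hu : RegularOn u K R)
    {W : ℝ → ℝ} {x x' : ℝ} (hx : |x| < r) (hx' : |x'| < r) (hW' : W x' = 0)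
    (hW : ∀ s, |s| < r → HasDerivAt W (u (s, Y s x')) s) :
    |W x + (x' - x) * u (x, 0)| ≤ 2 * K ^ 2 * (x' - x) ^ 2 := by
  have hsub : ∀ v ∈ uIcc x' x, |v| < r := fun v hv =>
    abs_lt.2 (ordConnected_Ioo.uIcc_subset (abs_lt.1 hx') (abs_lt.1 hx) hv)
  have hd : ∀ v ∈ uIcc x' x, HasDerivWithinAt (fun v => W v - v * u (x, 0))
      (u (v, Y v x') - u (x, 0)) (uIcc x' x) v := fun v hv => by
    simpa using ((hW v (hsub v hv)).fun_sub
      ((hasDerivAt_id' v).mul_const (u (x, 0)))).hasDerivWithinAt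
  have hb : ∀ v ∈ uIcc x' x, ‖u (v, Y v x') - u (x, 0)‖ ≤ 2 * K ^ 2 * |x' - x| := fun v hv => by
    refine (hu.lip _ (h.mem x' hx' v (hsub v hv)) _ (h.mem_axis hx)).trans ?_
    have h1 := h.bound x' hx' v (hsub v hv)
    have h2 : |v - x'| ≤ |x' - x| := by
      rw [abs_sub_comm x' x]; exact abs_sub_left_of_mem_uIcc hv
    have h3 : |v - x| ≤ |x' - x| := by
      rw [uIcc_comm] at hv; exact abs_sub_left_of_mem_uIcc hv
    have hK := h.one_le
    have h4 : ‖((v, Y v x') : ℝ × ℝ) - (x, 0)‖ ≤ 2 * K * |x' - x| := by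
      simp only [Prod.mk_sub_mk, Prod.norm_def, Real.norm_eq_abs, sub_zero]
      refine max_le ?_ ?_ <;> nlinarith [abs_nonneg (x' - x), abs_nonneg (v - x')]
    nlinarith
  have := (convex_uIcc x' x).norm_image_sub_le_of_norm_hasDerivWithin_le hd hb left_mem_uIcc
    right_mem_uIcc
  rw [Real.norm_eq_abs, Real.norm_eq_abs, abs_sub_comm x x', mul_assoc, ← sq, sq_abs, hW'] at this
  convert this using 2
  ring

/-- Variation of constants: multiplied by `exp (-P)`, the difference of two orbits loses the linear
term of its equation, and only the quadratic Taylor remainder is left to integrate. The initial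
difference, at abscissa `x`, is `-(x' - x)` times the slope at `(x, 0)`, up to a quadratic error. -/
theorem exists_initialDeriv_bound (h : IsGraphFlow F Y K R r) :
    ∃ C, ∀ x, |x| < r → ∀ x', |x'| < r → ∀ s, |s| < r →
      |Y s x' - Y s x - (x' - x) * initialDeriv F Y s x| ≤ C * (x' - x) ^ 2 := by
  set E := Real.exp (2 * K) with hE
  set L := K * E with hL
  -- `2K²` comes from the initial difference, the other summand from the Taylor remainder over a
  -- length at most `2`, and the outer `E` from undoing the factor `exp (-P)`.
  refine ⟨E * (2 * K ^ 2 + E * (K * L ^ 2) * 2), fun x hx x' hx' s hs => ?_⟩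
  set P := fun s => logSeparation F Y s x with hP
  have hPd : ∀ v, |v| < r → HasDerivAt P (partialY (orbitSlope F) (v, Y v x)) v := fun v hv =>
    h.hasDerivAt_integral_graph hx hv (h.regular_slope.continuousOn_partialY h.pos_R)
  have hPE : ∀ v, |v| < r → Real.exp (P v) ≤ E ∧ Real.exp (-P v) ≤ E := fun v hv => by
    have := abs_le.1 (h.abs_logSeparation_le' hx hv)
    exact ⟨Real.exp_le_exp.2 this.2, Real.exp_le_exp.2 (by linarith [this.1])⟩
  have hK := h.K_nonneg
  have hd : ∀ v ∈ Ioo (-r) r, HasDerivWithinAt (fun v => Real.exp (-P v) * (Y v x' - Y v x))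
      (Real.exp (-P v) * (orbitSlope F (v, Y v x') - orbitSlope F (v, Y v x) -
        partialY (orbitSlope F) (v, Y v x) * (Y v x' - Y v x))) (Ioo (-r) r) v := fun v hv => by
    refine ((hPd v (abs_lt.2 hv)).fun_neg.exp.hasDerivWithinAt.mul
      (h.diff_deriv hx hx' v hv)).congr_deriv ?_
    ring
  have hb : ∀ v ∈ Ioo (-r) r, ‖Real.exp (-P v) * (orbitSlope F (v, Y v x') -
      orbitSlope F (v, Y v x) - partialY (orbitSlope F) (v, Y v x) * (Y v x' - Y v x))‖ ≤
      E * (K * (L * |x' - x|) ^ 2) := fun v hv => by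
    have hv' := abs_lt.2 hv
    rw [Real.norm_eq_abs, abs_mul, abs_of_pos (Real.exp_pos _)]
    have h1 := h.regular_slope.abs_taylor_le h.pos_R (h.mem x hx v hv') (h.mem x' hx' v hv')
    have h2 := h.lipschitz hx hx' hv'
    refine mul_le_mul (hPE v hv').2 (h1.trans ?_) (abs_nonneg _) (Real.exp_pos _).le
    gcongr
  have hmain := (convex_Ioo (-r) r).norm_image_sub_le_of_norm_hasDerivWithin_le hd hb
    (abs_lt.1 hx) (abs_lt.1 hs)
  have hstart := h.abs_integral_sub_le h.regular_slope (W := fun s => Y s x') hx hx' (h.start x' hx') (h.deriv x' hx')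
  have hPx : P x = 0 := by simp [hP, logSeparation]
  simp only [hPx, neg_zero, Real.exp_zero, one_mul, h.start x hx, sub_zero] at hmain
  have hsx : ‖s - x‖ ≤ 2 := by
    have := abs_sub s x
    rw [Real.norm_eq_abs]; linarith [h.le_one]
  have hEpos := Real.exp_pos (2 * K)
  have h3 : |Real.exp (-P s) * (Y s x' - Y s x) + (x' - x) * orbitSlope F (x, 0)| ≤
      (2 * K ^ 2 + E * (K * L ^ 2) * 2) * (x' - x) ^ 2 := by
    have h4 : ‖Real.exp (-P s) * (Y s x' - Y s x) - Y x x'‖ ≤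
        E * (K * (L * |x' - x|) ^ 2) * 2 :=
      hmain.trans (mul_le_mul_of_nonneg_left hsx (by positivity))
    rw [mul_pow, sq_abs] at h4
    calc _ = |(Real.exp (-P s) * (Y s x' - Y s x) - Y x x') +
          (Y x x' + (x' - x) * orbitSlope F (x, 0))| := by congr 1; ring
      _ ≤ _ := abs_add_le _ _
      _ ≤ E * (K * (L ^ 2 * (x' - x) ^ 2)) * 2 + 2 * K ^ 2 * (x' - x) ^ 2 := add_le_add h4 hstart
      _ = _ := by ring
  have h5 : Y s x' - Y s x - (x' - x) * initialDeriv F Y s x = Real.exp (P s) *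
      (Real.exp (-P s) * (Y s x' - Y s x) + (x' - x) * orbitSlope F (x, 0)) := by
    have : Real.exp (P s) * Real.exp (-P s) = 1 := by rw [← Real.exp_add]; simp
    rw [initialDeriv]
    linear_combination -(Y s x' - Y s x) * this
  rw [h5, abs_mul, abs_of_pos (Real.exp_pos _), mul_assoc]
  exact mul_le_mul (hPE s hs).1 h3 (abs_nonneg _) hEpos.le

theorem hasDerivAt_initial (h : IsGraphFlow F Y K R r) {x s : ℝ} (hx : |x| < r) (hs : |s| < r) :
    HasDerivAt (fun x => Y s x) (initialDeriv F Y s x) x := by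
  obtain ⟨C, hC⟩ := h.exists_initialDeriv_bound
  refine hasDerivAt_of_abs_sub_le_sq (C := C) ?_
  filter_upwards [(continuous_abs.tendsto x).eventually_lt_const hx] with x' hx'
  exact hC x hx x' hx' s hs

theorem continuousOn_initialDeriv (h : IsGraphFlow F Y K R r) {x : ℝ} (hx : |x| < r) :
    ContinuousOn (fun s => initialDeriv F Y s x) (Ioo (-r) r) := by
  refine continuousOn_const.mul (Real.continuous_exp.comp_continuousOn fun s hs => ?_)
  exact (h.hasDerivAt_integral_graph hx (abs_lt.2 hs)
    (h.regular_slope.continuousOn_partialY h.pos_R)).continuousAt.continuousWithinAt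

theorem abs_initialDeriv_le (h : IsGraphFlow F Y K R r) {x s : ℝ} (hx : |x| < r) (hs : |s| < r) :
    |initialDeriv F Y s x| ≤ K * Real.exp (2 * K) := by
  rw [initialDeriv, abs_mul, abs_neg, abs_of_pos (Real.exp_pos _)]
  exact mul_le_mul (h.regular_slope.bound _ (h.mem_axis hx))
    (Real.exp_le_exp.2 (le_of_abs_le (h.abs_logSeparation_le' hx hs))) (Real.exp_pos _).le
    h.K_nonneg

/-- Differentiation under the integral sign, done by comparing derivatives in the upper limit `v`;
the motion of the lower limit contributes the boundary term `-1/X(x, 0)`. -/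
theorem hasDerivAt_timeToAxis (h : IsGraphFlow F Y K R r) {x : ℝ} (hx : |x| < r) :
    HasDerivAt (timeToAxis F Y) (timeToAxisDeriv F Y x) x := by
  obtain ⟨C, hC⟩ := h.exists_initialDeriv_bound
  have hK := h.K_nonneg
  set L := K * Real.exp (2 * K) with hL
  refine hasDerivAt_of_abs_sub_le_sq (C := (K * L ^ 2 + K * C) * 1 + 2 * K ^ 2) ?_
  filter_upwards [(continuous_abs.tendsto x).eventually_lt_const hx] with x' hx'
  have h0 : |(0 : ℝ)| < r := by simpa using h.pos
  set m := slowness F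
  have hmc := h.regular_slowness.continuousOn h.pos_R
  set Θ := fun z s => ∫ u in z..s, m (u, Y u z) with hΘ
  have hΘd : ∀ z, |z| < r → ∀ s, |s| < r → HasDerivAt (Θ z) (m (s, Y s z)) s := fun z hz s hs =>
    h.hasDerivAt_integral_graph hz hs hmc
  set J := fun s => ∫ u in x..s, partialY m (u, Y u x) * initialDeriv F Y u x with hJ
  have hJd : ∀ s, |s| < r → HasDerivAt J (partialY m (s, Y s x) * initialDeriv F Y s x) s :=
    fun s hs => hasDerivAt_integral_Ioo ((h.continuousOn_comp_graph hx
      (h.regular_slowness.continuousOn_partialY h.pos_R)).mul (h.continuousOn_initialDeriv hx))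
      (abs_lt.1 hx) (abs_lt.1 hs)
  have hd : ∀ v ∈ Ioo (-r) r, HasDerivWithinAt (fun v => Θ x' v - Θ x v - (x' - x) * J v)
      (m (v, Y v x') - m (v, Y v x) -
        (x' - x) * (partialY m (v, Y v x) * initialDeriv F Y v x)) (Ioo (-r) r) v := fun v hv =>
    (((hΘd x' hx' v (abs_lt.2 hv)).sub (hΘd x hx v (abs_lt.2 hv))).sub
      ((hJd v (abs_lt.2 hv)).const_mul (x' - x))).hasDerivWithinAt
  have hb : ∀ v ∈ Ioo (-r) r, ‖m (v, Y v x') - m (v, Y v x) -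
      (x' - x) * (partialY m (v, Y v x) * initialDeriv F Y v x)‖ ≤
      (K * L ^ 2 + K * C) * (x' - x) ^ 2 := fun v hv => by
    have hv' := abs_lt.2 hv
    have h1 := h.regular_slowness.abs_taylor_le h.pos_R (h.mem x hx v hv') (h.mem x' hx' v hv')
    have h2 := h.lipschitz hx hx' hv'
    have h3 : K * |Y v x' - Y v x| ^ 2 ≤ K * (L * |x' - x|) ^ 2 := by gcongr
    rw [mul_pow L, sq_abs (x' - x)] at h3
    have h4 : |partialY m (v, Y v x) * (Y v x' - Y v x - (x' - x) * initialDeriv F Y v x)| ≤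
        K * (C * (x' - x) ^ 2) := by
      rw [abs_mul]
      exact mul_le_mul (h.regular_slowness.partial_bound _ (h.mem x hx v hv'))
        (hC x hx x' hx' v hv') (abs_nonneg _) hK
    calc _ = |(m (v, Y v x') - m (v, Y v x) - partialY m (v, Y v x) * (Y v x' - Y v x)) +
          partialY m (v, Y v x) * (Y v x' - Y v x - (x' - x) * initialDeriv F Y v x)| := by
          rw [Real.norm_eq_abs]; congr 1; ring
      _ ≤ _ := abs_add_le _ _
      _ ≤ K * (L ^ 2 * (x' - x) ^ 2) + K * (C * (x' - x) ^ 2) := add_le_add (h1.trans h3) h4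
      _ = _ := by ring
  have hmain := (convex_Ioo (-r) r).norm_image_sub_le_of_norm_hasDerivWithin_le hd hb
    (abs_lt.1 hx) (abs_lt.1 h0)
  have hstart := h.abs_integral_sub_le h.regular_slowness hx hx'
    (W := Θ x') (by simp [hΘ]) (hΘd x' hx')
  have hΘx : Θ x x = 0 := by simp [hΘ]
  have hJx : J x = 0 := by simp [hJ]
  rw [hΘx, hJx, mul_zero, sub_zero, sub_zero] at hmain
  have hx1 : ‖0 - x‖ ≤ 1 := by
    rw [zero_sub, norm_neg, Real.norm_eq_abs]; linarith [h.le_one]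
  have h5 := hmain.trans (mul_le_mul_of_nonneg_left hx1 ((norm_nonneg _).trans (hb 0 (abs_lt.1 h0))))
  calc _ = |(Θ x' 0 - Θ x 0 - (x' - x) * J 0 - Θ x' x) + (Θ x' x + (x' - x) * m (x, 0))| := by
        congr 1; simp only [timeToAxis, timeToAxisDeriv, hΘ, hJ]; ring
    _ ≤ _ := abs_add_le _ _
    _ ≤ _ := add_le_add h5 hstart
    _ = _ := by ring

theorem tendsto_timeToAxisDeriv (h : IsGraphFlow F Y K R r) :
    Tendsto (timeToAxisDeriv F Y) (𝓝 0) (𝓝 (-slowness F 0)) := by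
  have hax : Tendsto (fun x : ℝ => (x, (0 : ℝ))) (𝓝 0) (𝓝 0) :=
    (continuous_id.prodMk continuous_const).tendsto' 0 0 rfl
  have h1 : Tendsto (fun x : ℝ => slowness F (x, 0)) (𝓝 0) (𝓝 (slowness F 0)) :=
    ((h.regular_slowness.continuousOn h.pos_R).continuousAt
      (Metric.ball_mem_nhds _ h.pos_R)).tendsto.comp hax
  have h2 : Tendsto (fun x : ℝ => ∫ u in x..0, partialY (slowness F) (u, Y u x) *
      initialDeriv F Y u x) (𝓝 0) (𝓝 0) := by
    refine squeeze_zero_norm' (a := fun x => K * (K * Real.exp (2 * K)) * |0 - x|) ?_ ?_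
    · filter_upwards [(continuous_abs.tendsto 0).eventually_lt_const
        (by simpa using h.pos : |(0 : ℝ)| < r)] with x hx
      refine intervalIntegral.norm_integral_le_of_norm_le_const fun u hu => ?_
      have hu' : |u| < r := abs_lt.2 <| ordConnected_Ioo.uIcc_subset (abs_lt.1 hx)
        (abs_lt.1 (by simpa using h.pos : |(0 : ℝ)| < r)) (uIoc_subset_uIcc hu)
      rw [norm_mul]
      exact mul_le_mul (h.regular_slowness.partial_bound _ (h.mem x hx u hu'))
        (h.abs_initialDeriv_le hx hu') (abs_nonneg _) h.K_nonneg
    · exact (by fun_prop : Continuous fun x : ℝ => K * (K * Real.exp (2 * K)) * |0 - x|).tendsto'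
        0 0 (by simp)
  have := h1.neg.add h2
  rwa [add_zero] at this

/-- The flight time between two points of `Σ` on the same orbit. -/
theorem integral_slowness_eq (h : IsGraphFlow F Y K R r) {x b : ℝ} (hx : |x| < r) (hb : |b| < r)
    (hz : Y b x = 0) :
    ∫ u in x..b, slowness F (u, Y u x) = timeToAxis F Y x - timeToAxis F Y b := by
  have h0 : |(0 : ℝ)| < r := by simpa using h.pos
  have hmc := h.regular_slowness.continuousOn h.pos_R
  have hint : ∀ a c, |a| < r → |c| < r →
      IntervalIntegrable (fun u => slowness F (u, Y u x)) MeasureTheory.volume a c :=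
    fun a c ha hc => ((h.continuousOn_comp_graph hx hmc).mono
      (ordConnected_Ioo.uIcc_subset (abs_lt.1 ha) (abs_lt.1 hc))).intervalIntegrable
  -- `(b, 0)` lies on the orbit of `(x, 0)`, so both integrands agree.
  have hbeq : timeToAxis F Y b = ∫ u in b..0, slowness F (u, Y u x) :=
    intervalIntegral.integral_congr fun u hu => by
      have hu' : |u| < r :=
        abs_lt.2 (ordConnected_Ioo.uIcc_subset (abs_lt.1 hb) (abs_lt.1 h0) hu)
      simp only [h.eq_of_zero hx hb hu' hz]
  rw [hbeq, timeToAxis, ← intervalIntegral.integral_add_adjacent_intervals (hint x b hx hb)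
    (hint b 0 hb h0)]
  ring

end IsGraphFlow

/-! ### Contacts -/

section Contact

variable {F : ℝ × ℝ → ℝ × ℝ} {V : Set (ℝ × ℝ)}

theorem contDiffOn_lieIter {h : ℝ × ℝ → ℝ} (hV : IsOpen V) (hF : ContDiffOn ℝ ∞ F V)
    (hh : ContDiffOn ℝ ∞ h V) (n : ℕ) : ContDiffOn ℝ ∞ (lieIter F h n) V := by
  induction n with
  | zero => exact hh
  | succ n ih => exact (ih.fderiv_of_isOpen hV (by simp)).clm_apply hF

theorem lieIter_snd_one (p : ℝ × ℝ) : lieIter F Prod.snd 1 p = (F p).2 := by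
  change fderiv ℝ (fun q : ℝ × ℝ => q.2) p (F p) = (F p).2
  rw [fderiv_snd]
  rfl

theorem IsContact.lieIter_eq_zero {h : ℝ × ℝ → ℝ} {p : ℝ × ℝ} {k i : ℕ} (hc : IsContact F h p k)
    (hi : i < k) : lieIter F h i p = 0 := by
  rcases Nat.eq_zero_or_pos i with rfl | h0
  · exact hc.1
  · exact hc.2.1 i h0 hi

/-- Multiplicity at least 2 gives `Y = 0` at the origin; if also `X = 0`, every Lie derivative
vanishes there, including the one that must not. -/
theorem IsContact.fst_ne_zero {k : ℕ} (hc : IsContact F Prod.snd 0 (k + 1)) (hk : 1 ≤ k) :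
    (F 0).1 ≠ 0 := fun h0 => by
  have h1 : (F 0).2 = 0 := by
    rw [← lieIter_snd_one]
    exact hc.lieIter_eq_zero (by omega)
  have hF : F 0 = 0 := Prod.ext h0 h1
  apply hc.2.2
  simp only [lieIter, hF, map_zero]

end Contact

/-! ### Leading terms at a contact -/

namespace IsGraphFlow

variable {F : ℝ × ℝ → ℝ × ℝ} {Y : ℝ → ℝ → ℝ} {K R r : ℝ} {V : Set (ℝ × ℝ)}

theorem abs_zero_lt (h : IsGraphFlow F Y K R r) : |(0 : ℝ)| < r := by simpa using h.pos

theorem eventually_abs_lt (h : IsGraphFlow F Y K R r) : ∀ᶠ x in 𝓝 (0 : ℝ), |x| < r :=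
  (continuous_abs.tendsto 0).eventually_lt_const h.abs_zero_lt

theorem tendsto_graph_zero (h : IsGraphFlow F Y K R r) :
    Tendsto (fun s => (s, Y s 0)) (𝓝 0) (𝓝 0) := by
  have h1 := (h.continuousOn_graph h.abs_zero_lt).continuousAt
    (Ioo_mem_nhds (by linarith [h.pos] : -r < 0) h.pos)
  have h2 : ((0 : ℝ), Y 0 0) = 0 := by rw [h.start 0 h.abs_zero_lt]; rfl
  have := h1.tendsto
  rwa [h2] at this

theorem hasDerivAt_comp_graph (h : IsGraphFlow F Y K R r) {u : ℝ × ℝ → ℝ} {x s : ℝ} (hx : |x| < r)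
    (hs : |s| < r) (hu : DifferentiableAt ℝ u (s, Y s x)) :
    HasDerivAt (fun s => u (s, Y s x))
      (slowness F (s, Y s x) * fderiv ℝ u (s, Y s x) (F (s, Y s x))) s := by
  have h1 : HasDerivAt (fun s => (s, Y s x)) (1, orbitSlope F (s, Y s x)) s :=
    (hasDerivAt_id s).prodMk (h.deriv x hx s hs)
  refine (hu.hasFDerivAt.comp_hasDerivAt s h1).congr_deriv ?_
  rw [← smul_eq_mul (slowness F (s, Y s x)), ← map_smul]
  congr 1
  have := h.speed_ne (h.mem x hx s hs)
  ext
  · simp [slowness, this]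
  · simp [slowness, orbitSlope, div_eq_inv_mul]

theorem tendsto_slowness_graph (h : IsGraphFlow F Y K R r) :
    Tendsto (fun s => slowness F (s, Y s 0)) (𝓝 0) (𝓝 (slowness F 0)) :=
  ((h.regular_slowness.continuousOn h.pos_R).continuousAt
    (Metric.ball_mem_nhds _ h.pos_R)).tendsto.comp h.tendsto_graph_zero

/-- Along the orbit of the origin, `d/ds` of `F^i h` is `F^(i+1) h / X`, so each step down in `i`
integrates once and raises the power of `s` by one. -/
theorem tendsto_lieIter_div_pow (h : IsGraphFlow F Y K R r) (hV : IsOpen V) (h0 : 0 ∈ V)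
    (hF : ContDiffOn ℝ ∞ F V) {k : ℕ} (hc : IsContact F Prod.snd 0 k) (j i : ℕ) (hij : i + j = k) :
    Tendsto (fun s => lieIter F Prod.snd i (s, Y s 0) / s ^ j) (𝓝[≠] 0)
      (𝓝 (lieIter F Prod.snd k 0 * slowness F 0 ^ j / j.factorial)) := by
  have hL := contDiffOn_lieIter hV hF contDiff_snd.contDiffOn
  induction j generalizing i with
  | zero =>
    obtain rfl : i = k := by omega
    simpa [Function.comp_def] using (((hL i).continuousOn.continuousAt (hV.mem_nhds h0)).tendsto.comp
      h.tendsto_graph_zero).mono_left nhdsWithin_le_nhds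
  | succ j ih =>
    have hder : ∀ᶠ s in 𝓝 (0 : ℝ), HasDerivAt (fun s => lieIter F Prod.snd i (s, Y s 0))
        (slowness F (s, Y s 0) * lieIter F Prod.snd (i + 1) (s, Y s 0)) s := by
      filter_upwards [h.eventually_abs_lt, h.tendsto_graph_zero.eventually (hV.mem_nhds h0)]
        with s hs hsV
      exact h.hasDerivAt_comp_graph h.abs_zero_lt hs
        (((hL i).contDiffAt (hV.mem_nhds hsV)).differentiableAt (by simp))
    have hz : lieIter F Prod.snd i (0, Y 0 0) = 0 := by
      rw [h.start 0 h.abs_zero_lt]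
      exact hc.lieIter_eq_zero (by omega)
    have hlim := (h.tendsto_slowness_graph.mono_left nhdsWithin_le_nhds).mul
      (ih (i + 1) (by omega))
    have := tendsto_div_pow_succ_of_deriv hder hz
      (hlim.congr fun s => (mul_div_assoc _ _ _).symm)
    convert this using 2
    rw [Nat.factorial_succ]
    push_cast
    field_simp
    ring

/-- `g' x` is minus the slope at `(x, 0)` times a factor tending to `1`, so only the order of that
slope matters. With `n` odd, `1/X(0)` enters `B` to an even power, so its sign does not affect that
of `B`. -/
theorem exists_contact_asymptotics (h : IsGraphFlow F Y K R r) (hV : IsOpen V) (h0 : 0 ∈ V)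
    (hF : ContDiffOn ℝ ∞ F V) {n : ℕ} (hn : Odd n) (hc : IsContact F Prod.snd 0 (n + 1)) {σ : ℝ}
    (hσ : σ * lieIter F Prod.snd (n + 1) 0 < 0) :
    ∃ B, 0 < σ * B ∧
      Tendsto (fun x => initialDeriv F Y 0 x / x ^ n) (𝓝[≠] 0) (𝓝 B) ∧
      Tendsto (fun x => Y 0 x / x ^ (n + 1)) (𝓝[≠] 0) (𝓝 (B / (n + 1))) := by
  set a := lieIter F Prod.snd (n + 1) 0
  set m := slowness F 0 with hm
  have hm0 : m ≠ 0 := one_div_ne_zero (hc.fst_ne_zero hn.pos)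
  have hY : Tendsto (fun s => Y s 0 / s ^ (n + 1)) (𝓝[≠] 0) _ :=
    h.tendsto_lieIter_div_pow hV h0 hF hc (n + 1) 0 (by omega)
  have hU := (h.tendsto_slowness_graph.mono_left nhdsWithin_le_nhds).mul
    (h.tendsto_lieIter_div_pow hV h0 hF hc n 1 (by omega))
  have hid : Tendsto (fun s : ℝ => s) (𝓝[≠] 0) (𝓝 0) := tendsto_id.mono_left nhdsWithin_le_nhds
  have hYn : Tendsto (fun s => K * |Y s 0 / s ^ n|) (𝓝[≠] 0) (𝓝 0) := by
    have := ((hY.mul hid).abs.const_mul K)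
    rw [mul_zero, abs_zero, mul_zero] at this
    refine this.congr' ?_
    filter_upwards [self_mem_nhdsWithin] with s hs
    have : s ≠ 0 := hs
    congr 2
    field_simp
    ring
  -- The slope on `Σ` and the slope on the orbit of the origin differ by at most `K |Y s 0|`, which
  -- is of order `s^(n+1)`.
  have hdiff : Tendsto (fun s => orbitSlope F (s, 0) / s ^ n - orbitSlope F (s, Y s 0) / s ^ n)
      (𝓝[≠] 0) (𝓝 0) := by
    refine squeeze_zero_norm' ?_ hYn
    filter_upwards [nhdsWithin_le_nhds h.eventually_abs_lt] with s hs
    rw [← sub_div, norm_div, abs_div, ← mul_div_assoc, Real.norm_eq_abs, Real.norm_eq_abs]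
    gcongr
    have := h.regular_slope.abs_sub_le (h.mem_axis hs) (h.mem 0 h.abs_zero_lt s hs)
    rwa [abs_sub_comm, sub_zero] at this
  have hslope : Tendsto (fun s => orbitSlope F (s, 0) / s ^ n) (𝓝[≠] 0)
      (𝓝 (m * (a * m ^ n / n.factorial))) := by
    have := hdiff.add hU
    rw [zero_add] at this
    refine this.congr fun s => ?_
    rw [lieIter_snd_one, orbitSlope, orbitSlope, slowness]
    ring
  have hexp : Tendsto (fun x => Real.exp (logSeparation F Y 0 x)) (𝓝[≠] 0) (𝓝 1) := by
    have : Tendsto (fun x => logSeparation F Y 0 x) (𝓝 0) (𝓝 0) := by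
      refine squeeze_zero_norm' (a := fun x => K * |0 - x|) ?_ ?_
      · filter_upwards [h.eventually_abs_lt] with x hx
        exact h.abs_logSeparation_le hx h.abs_zero_lt
      · exact (by fun_prop : Continuous fun x : ℝ => K * |0 - x|).tendsto' 0 0 (by simp)
    have := (Real.continuous_exp.tendsto 0).comp this
    rw [Real.exp_zero] at this
    exact this.mono_left nhdsWithin_le_nhds
  have hD : Tendsto (fun x => initialDeriv F Y 0 x / x ^ n) (𝓝[≠] 0)
      (𝓝 (-(m * (a * m ^ n / n.factorial)))) := by
    have := hslope.neg.mul hexp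
    rw [mul_one] at this
    refine this.congr fun x => ?_
    rw [initialDeriv]
    ring
  refine ⟨_, ?_, hD, tendsto_div_pow_succ_of_deriv ?_ (h.start 0 h.abs_zero_lt) hD⟩
  · have h1 : 0 < m ^ (n + 1) := hn.add_one.pow_pos hm0
    have h2 : 0 < (n.factorial : ℝ) := by positivity
    have : σ * -(m * (a * m ^ n / n.factorial)) = -(σ * a) * (m ^ (n + 1) / n.factorial) := by ring
    rw [this]
    exact mul_pos (by linarith) (by positivity)
  · filter_upwards [h.eventually_abs_lt] with x hx
    exact h.hasDerivAt_initial hx h.abs_zero_lt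

end IsGraphFlow

/-! ### Trajectories and graphs -/

theorem nonneg_of_hasDerivWithinAt_of_nonneg {W : ℝ → ℝ} {d τ : ℝ} (hτ : 0 < τ)
    (hW : HasDerivWithinAt W d (Icc 0 τ) 0) (h0 : W 0 = 0) (hpos : ∀ t ∈ Ioo 0 τ, 0 < W t) :
    0 ≤ d := by
  have h1 := hW.mono Ioo_subset_Icc_self
  rw [hasDerivWithinAt_iff_tendsto_slope' (by simp)] at h1
  have := left_nhdsWithin_Ioo_neBot hτ
  refine ge_of_tendsto h1 ?_
  filter_upwards [self_mem_nhdsWithin] with t ht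
  rw [slope_def_field, h0, sub_zero, sub_zero]
  exact (div_pos (hpos t ht) ht.1).le

namespace IsGraphFlow

variable {F : ℝ × ℝ → ℝ × ℝ} {Y : ℝ → ℝ → ℝ} {K R r : ℝ}

section Trajectory

variable {e : ℝ} {p q : ℝ → ℝ} {I : Set ℝ}

/-- A trajectory that meets the graph of an orbit stays on it. -/
theorem trajectory_eq_graph (h : IsGraphFlow F Y K R r) (he : |e| = 1) (hI : Convex ℝ I)
    (hp : ∀ t ∈ I, HasDerivWithinAt p (e * (F (p t, q t)).1) I t)
    (hq : ∀ t ∈ I, HasDerivWithinAt q (e * (F (p t, q t)).2) I t)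
    (hball : ∀ t ∈ I, (p t, q t) ∈ Metric.ball (0 : ℝ × ℝ) R) (hpr : ∀ t ∈ I, |p t| < r)
    {x s t : ℝ} (hx : |x| < r) (hs : s ∈ I) (ht : t ∈ I) (hsq : q s = Y (p s) x) :
    q t = Y (p t) x := by
  have hd : ∀ t ∈ I, HasDerivWithinAt (fun t => q t - Y (p t) x)
      (e * (F (p t, q t)).1 * (orbitSlope F (p t, q t) - orbitSlope F (p t, Y (p t) x))) I t := by
    intro t ht
    have h1 := (h.deriv x hx (p t) (hpr t ht)).comp_hasDerivWithinAt t (hp t ht)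
    refine ((hq t ht).sub h1).congr_deriv ?_
    have : (F (p t, q t)).2 = (F (p t, q t)).1 * orbitSlope F (p t, q t) := by
      rw [orbitSlope, mul_div_cancel₀ _ (h.speed_ne (hball t ht))]
    rw [this]
    ring
  have hb : ∀ t ∈ I, |e * (F (p t, q t)).1 * (orbitSlope F (p t, q t) -
      orbitSlope F (p t, Y (p t) x))| ≤ (K * K) * |q t - Y (p t) x| := by
    intro t ht
    rw [abs_mul, abs_mul, he, one_mul, mul_assoc]
    exact mul_le_mul (h.speed_le _ (hball t ht))
      (h.regular_slope.abs_sub_le (h.mem x hx _ (hpr t ht)) (hball t ht)) (abs_nonneg _) h.K_nonneg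
  have := abs_le_abs_mul_exp_of_abs_deriv_le hI hd hb ht hs
  rw [hsq, sub_self, abs_zero, zero_mul] at this
  exact sub_eq_zero.1 (abs_nonpos_iff.1 this)

theorem trajectory_monotoneOn (h : IsGraphFlow F Y K R r) (he : e * e = 1) (hI : Convex ℝ I)
    (hp : ∀ t ∈ I, HasDerivWithinAt p (e * (F (p t, q t)).1) I t)
    (hball : ∀ t ∈ I, (p t, q t) ∈ Metric.ball (0 : ℝ × ℝ) R) :
    MonotoneOn (fun t => e * (F 0).1 * p t) I :=
  monotoneOn_of_hasDerivWithinAt_nonneg hI (fun t ht => (hp t ht).const_mul (e * (F 0).1))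
    fun t ht => by
      have : e * (F 0).1 * (e * (F (p t, q t)).1) = (e * e) * ((F 0).1 * (F (p t, q t)).1) := by ring
      rw [this, he, one_mul]
      exact (h.speed_pos _ (hball t ht)).le

end Trajectory

variable {e σ x b τ : ℝ} {p q : ℝ → ℝ}

theorem trajectory_direction (h : IsGraphFlow F Y K R r) (he : e * e = 1) (hx : |x| < r)
    (hslope : σ * orbitSlope F (x, 0) * x < 0) (hτ : 0 < τ) (hp0 : p 0 = x) (hq0 : q 0 = 0)
    (hpos : ∀ t ∈ Ioo 0 τ, 0 < σ * q t)
    (hq : ∀ t ∈ Icc 0 τ, HasDerivWithinAt q (e * (F (p t, q t)).2) (Icc 0 τ) t) :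
    e * (F 0).1 * x < 0 := by
  have h1 := nonneg_of_hasDerivWithinAt_of_nonneg hτ
    ((hq 0 (left_mem_Icc.2 hτ.le)).const_mul σ) (by simp [hq0]) hpos
  rw [hp0, hq0] at h1
  have h2 := h.speed_pos _ (h.mem_axis hx)
  have h3 : (F (x, 0)).2 = (F (x, 0)).1 * orbitSlope F (x, 0) := by
    rw [orbitSlope, mul_div_cancel₀ _ (h.speed_ne (h.mem_axis hx))]
  rw [h3] at h1
  have hx0 : x ≠ 0 := fun h0 => by simp [h0] at hslope
  by_contra! hcon
  have h4 : 0 < e * (F 0).1 * x := lt_of_le_of_ne hcon <| Ne.symm <| mul_ne_zero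
    (mul_ne_zero (fun h0 => by simp [h0] at he) (left_ne_zero_of_mul h2.ne')) hx0
  have h5 : (e * (F 0).1 * x) * ((F 0).1 * (F (x, 0)).1) * (σ * orbitSlope F (x, 0) * x) < 0 :=
    mul_neg_of_pos_of_neg (mul_pos h4 h2) hslope
  -- Up to reordering, this is the product in `h5`, with the opposite sign.
  have h6 : 0 ≤ (F 0).1 ^ 2 * x ^ 2 * (σ * (e * ((F (x, 0)).1 * orbitSlope F (x, 0)))) := by
    positivity
  nlinarith

/-- A trajectory in a half plane that starts near the contact follows the graph of its orbit. -/
theorem arc_mem_graph (h : IsGraphFlow F Y K R r) (he : e * e = 1) (hx : 2 * |x| < r)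
    (hdir : e * (F 0).1 * x < 0) (hord : σ * Y 0 x < σ * Y 0 (-2 * x))
    (hp0 : p 0 = x) (hq0 : q 0 = 0) (hpos : ∀ t ∈ Ioo 0 τ, 0 < σ * q t)
    (hp : ∀ t ∈ Icc 0 τ, HasDerivWithinAt p (e * (F (p t, q t)).1) (Icc 0 τ) t)
    (hq : ∀ t ∈ Icc 0 τ, HasDerivWithinAt q (e * (F (p t, q t)).2) (Icc 0 τ) t) :
    ∀ t ∈ Icc 0 τ, |p t| ≤ 2 * |x| ∧ q t = Y (p t) x := by
  have hxr : |x| < r := by linarith [abs_nonneg x]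
  have h2x : |(-2 * x)| < r := by rw [abs_mul, abs_neg, abs_two]; exact hx
  set D := e * (F 0).1 with hD
  -- Orbits keep their order, so at abscissa `-2x` the orbit of `(x, 0)` is on the wrong side of
  -- `Σ`: the barrier.
  have hneg : σ * Y (-2 * x) x < 0 := by
    have := h.lt_of_lt hxr h2x h2x h.abs_zero_lt hord
    rwa [h.start _ h2x, mul_zero] at this
  have hpc : ContinuousOn p (Icc 0 τ) := fun t ht => (hp t ht).continuousWithinAt
  have hqc : ContinuousOn q (Icc 0 τ) := fun t ht => (hq t ht).continuousWithinAt
  have hDabs : ∀ z, D * x ≤ D * z → D * z ≤ D * (-2 * x) → |z| ≤ 2 * |x| := fun z h1 h2 => by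
    rcases lt_trichotomy D 0 with hD0 | hD0 | hD0
    · rw [mul_le_mul_left_of_neg hD0] at h1 h2
      have hx0 : 0 < x := pos_of_mul_neg_right hdir hD0.le
      rw [abs_of_pos hx0, abs_le]
      constructor <;> linarith
    · simp [hD0] at hdir
    · rw [mul_le_mul_iff_right₀ hD0] at h1 h2
      have hx0 : x < 0 := neg_of_mul_neg_right hdir hD0.le
      rw [abs_of_neg hx0, abs_le]
      constructor <;> linarith
  set S := {t | (D * p t ∈ Icc (D * x) (D * (-2 * x))) ∧ q t = Y (p t) x} with hS
  suffices hsub : Icc 0 τ ⊆ S from fun t ht => ⟨hDabs _ (hsub ht).1.1 (hsub ht).1.2, (hsub ht).2⟩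
  -- Continuous induction: the times up to which the trajectory is known to follow the graph form a
  -- closed set that can always be extended.
  refine IsClosed.Icc_subset_of_forall_exists_gt ?_ ?_ ?_
  · have hA : IsClosed (Icc 0 τ ∩ (fun t => D * p t) ⁻¹' Icc (D * x) (D * (-2 * x))) :=
      (continuousOn_const.mul hpc).preimage_isClosed_of_isClosed isClosed_Icc isClosed_Icc
    have hw : ContinuousOn (fun t => q t - Y (p t) x)
        (Icc 0 τ ∩ (fun t => D * p t) ⁻¹' Icc (D * x) (D * (-2 * x))) := by
      refine (hqc.mono inter_subset_left).sub fun t ht => ?_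
      have hpt : |p t| < r := (hDabs _ ht.2.1 ht.2.2).trans_lt hx
      exact (h.deriv x hxr (p t) hpt).continuousAt.comp_continuousWithinAt
        ((hpc t ht.1).mono inter_subset_left)
    convert hw.preimage_isClosed_of_isClosed hA (isClosed_singleton (x := (0 : ℝ))) using 1
    ext t
    simp only [hS, mem_inter_iff, mem_ofPred_eq, mem_preimage, mem_singleton_iff, sub_eq_zero]
    tauto
  · refine ⟨?_, by rw [hp0, hq0, h.start x hxr]⟩
    rw [hp0]
    constructor <;> linarith
  · intro t ⟨ht, ht0⟩ y hy
    have htI := Ico_subset_Icc_self ht0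
    have hpt : |p t| < r := (hDabs _ ht.1.1 ht.1.2).trans_lt hx
    have hγ : ContinuousWithinAt (fun u => (p u, q u)) (Icc 0 τ) t := (hpc t htI).prodMk (hqc t htI)
    have hmem : (p t, q t) ∈ Metric.ball (0 : ℝ × ℝ) R := by
      rw [ht.2]; exact h.mem x hxr _ hpt
    have hev : ∀ᶠ u in 𝓝[Icc 0 τ] t, (p u, q u) ∈ Metric.ball (0 : ℝ × ℝ) R ∧ |p u| < r :=
      (hγ.eventually (Metric.isOpen_ball.mem_nhds hmem)).and
        ((hpc t htI).abs.eventually_lt_const hpt)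
    obtain ⟨η, hη, hηs⟩ := Metric.mem_nhdsWithin_iff.1 hev
    obtain ⟨v, hv1, hv2⟩ := exists_between
      (lt_min (lt_min hy ht0.2) (lt_add_of_pos_right t hη) : t < min (min y τ) (t + η))
    simp only [lt_min_iff] at hv2
    have hJ : Icc t v ⊆ Icc 0 τ := Icc_subset_Icc ht0.1 hv2.1.2.le
    have hJS : ∀ u ∈ Icc t v, (p u, q u) ∈ Metric.ball (0 : ℝ × ℝ) R ∧ |p u| < r := fun u hu =>
      hηs ⟨by rw [Metric.mem_ball, Real.dist_eq, abs_of_nonneg (by linarith [hu.1])]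
              linarith [hu.2], hJ hu⟩
    have hqY : ∀ u ∈ Icc t v, q u = Y (p u) x := fun u hu =>
      h.trajectory_eq_graph (by nlinarith [abs_mul_abs_self e, abs_nonneg e]) (convex_Icc t v)
        (fun w hw => (hp w (hJ hw)).mono hJ) (fun w hw => (hq w (hJ hw)).mono hJ)
        (fun w hw => (hJS w hw).1) (fun w hw => (hJS w hw).2) hxr (left_mem_Icc.2 hv1.le) hu ht.2
    have hmono := h.trajectory_monotoneOn he (convex_Icc t v)
      (fun w hw => (hp w (hJ hw)).mono hJ) (fun w hw => (hJS w hw).1)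
    refine ⟨v, ⟨⟨ht.1.1.trans (hmono (left_mem_Icc.2 hv1.le) (right_mem_Icc.2 hv1.le) hv1.le), ?_⟩,
      hqY v (right_mem_Icc.2 hv1.le)⟩, hv1, hv2.1.1.le⟩
    -- Passing abscissa `-2x` would put the trajectory at the barrier, outside its half plane.
    by_contra! hcon
    obtain ⟨w, hw, hwx⟩ := intermediate_value_Icc hv1.le
      ((continuousOn_const (c := D)).mul (hpc.mono hJ)) ⟨ht.1.2, hcon.le⟩
    have hwx' : p w = -2 * x := mul_left_cancel₀ (left_ne_zero_of_mul hdir.ne) hwx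
    have hw0 : 0 < w := lt_of_le_of_ne (hJ hw).1 fun h0 => by
      rw [← h0, hp0] at hwx'
      exact (right_ne_zero_of_mul hdir.ne) (by linarith)
    have hqw := hpos w ⟨hw0, hw.2.trans_lt hv2.1.2⟩
    rw [hqY w hw, hwx'] at hqw
    exact hqw.not_gt hneg

/-- The end point and the duration of an arc in a half plane that starts near the contact. -/
theorem arc_endpoint (h : IsGraphFlow F Y K R r) (he : e * e = 1) (hx : 2 * |x| < r)
    (hslope : σ * orbitSlope F (x, 0) * x < 0) (hord : σ * Y 0 x < σ * Y 0 (-2 * x)) (hτ : 0 < τ)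
    (hp0 : p 0 = x) (hq0 : q 0 = 0) (hpτ : p τ = b) (hqτ : q τ = 0)
    (hpos : ∀ t ∈ Ioo 0 τ, 0 < σ * q t)
    (hp : ∀ t ∈ Icc 0 τ, HasDerivWithinAt p (e * (F (p t, q t)).1) (Icc 0 τ) t)
    (hq : ∀ t ∈ Icc 0 τ, HasDerivWithinAt q (e * (F (p t, q t)).2) (Icc 0 τ) t) :
    e * (F 0).1 * x < 0 ∧ |b| ≤ 2 * |x| ∧ b ≠ x ∧ Y b x = 0 ∧
      τ = e * ∫ u in x..b, slowness F (u, Y u x) := by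
  have hxr : |x| < r := by linarith [abs_nonneg x]
  have hdir := h.trajectory_direction he hxr hslope hτ hp0 hq0 hpos hq
  have hgraph := h.arc_mem_graph he hx hdir hord hp0 hq0 hpos hp hq
  have hτI := right_mem_Icc.2 hτ.le
  have hb := hgraph τ hτI
  rw [hpτ, hqτ] at hb
  have hd : ∀ t ∈ Icc 0 τ, HasDerivWithinAt
      (fun t => (∫ u in x..p t, slowness F (u, Y u x)) - e * t) 0 (Icc 0 τ) t := fun t ht => by
    obtain ⟨h1, h2⟩ := hgraph t ht
    have hpt : |p t| < r := h1.trans_lt hx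
    have h3 := (h.hasDerivAt_integral_graph hxr hpt
      (h.regular_slowness.continuousOn h.pos_R)).comp_hasDerivWithinAt t (hp t ht)
    refine (h3.sub ((hasDerivAt_id' t).const_mul e).hasDerivWithinAt).congr_deriv ?_
    rw [← h2, slowness]
    have := h.speed_ne (h.mem x hxr _ hpt)
    rw [← h2] at this
    field_simp
    ring
  have hconst := (convex_Icc 0 τ).norm_image_sub_le_of_norm_hasDerivWithin_le (C := 0) hd
    (fun t _ => by simp) (left_mem_Icc.2 hτ.le) hτI
  have hI : ∫ u in x..b, slowness F (u, Y u x) = e * τ := by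
    simpa [hp0, hpτ, sub_eq_zero] using hconst
  refine ⟨hdir, hb.1, fun hbx => ?_, hb.2.symm, ?_⟩
  · rw [hbx, intervalIntegral.integral_same] at hI
    have : e ≠ 0 := fun h0 => by simp [h0] at he
    exact (mul_ne_zero this hτ.ne') hI.symm
  · rw [hI, ← mul_assoc, he, one_mul]

end IsGraphFlow

/-! ### Functions comparable to an even power -/

/-- `σ g` grows with `|x|` on each side of `0`, within distance `ε`. -/
def GrowsOnSides (σ : ℝ) (g : ℝ → ℝ) (ε : ℝ) : Prop :=
  ∀ x b, 0 < x * b → |b| < ε → |x| < |b| → σ * g x < σ * g b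

section Even

variable {g g' φ : ℝ → ℝ} {σ B ε : ℝ} {n : ℕ}

theorem eventually_pos_mul (hn : Odd n) (hB : 0 < σ * B)
    (hg' : Tendsto (fun x => g' x / x ^ n) (𝓝[≠] 0) (𝓝 B)) :
    ∀ᶠ x in 𝓝[≠] (0 : ℝ), 0 < σ * g' x * x := by
  filter_upwards [(hg'.const_mul σ).eventually_const_lt hB, self_mem_nhdsWithin] with x hx hx0
  have hx0 : x ≠ 0 := hx0
  have h1 : 0 < x ^ (n + 1) := hn.add_one.pow_pos hx0
  have h2 : σ * g' x * x = σ * (g' x / x ^ n) * x ^ (n + 1) := by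
    field_simp
    ring
  rw [h2]
  exact mul_pos hx h1

theorem exists_growsOnSides (hn : Odd n) (hB : 0 < σ * B)
    (hg : ∀ᶠ x in 𝓝 (0 : ℝ), HasDerivAt g (g' x) x)
    (hg' : Tendsto (fun x => g' x / x ^ n) (𝓝[≠] 0) (𝓝 B)) : ∃ ε > 0, GrowsOnSides σ g ε := by
  have hev := eventually_nhdsWithin_iff.1 (eventually_pos_mul hn hB hg')
  obtain ⟨ε, hε, hball⟩ := Metric.eventually_nhds_iff.1 (hg.and hev)
  simp only [Real.dist_eq, sub_zero] at hball
  refine ⟨ε, hε, ?_⟩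
  have main : ∀ s : ℝ, s * s = 1 → StrictMonoOn (fun z => σ * g (s * z)) (Ioo 0 ε) := by
    intro s hs
    have habs : ∀ z ∈ Ioo 0 ε, |s * z| < ε ∧ s * z ≠ 0 := fun z hz => by
      have : |s| = 1 := by nlinarith [abs_mul_abs_self s, abs_nonneg s]
      refine ⟨by rw [abs_mul, this, one_mul, abs_of_pos hz.1]; exact hz.2, ?_⟩
      exact mul_ne_zero (fun h => by simp [h] at hs) hz.1.ne'
    have hd : ∀ z ∈ Ioo 0 ε, HasDerivAt (fun z => σ * g (s * z)) (σ * (g' (s * z) * s)) z :=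
      fun z hz => ((hball (habs z hz).1).1.comp z
        (by simpa using (hasDerivAt_id z).const_mul s)).const_mul σ
    refine strictMonoOn_of_deriv_pos (convex_Ioo 0 ε)
      (fun z hz => (hd z hz).continuousAt.continuousWithinAt) fun z hz => ?_
    rw [interior_Ioo] at hz
    rw [(hd z hz).deriv]
    have := (hball (habs z hz).1).2 (habs z hz).2
    have h2 : σ * g' (s * z) * (s * z) = σ * (g' (s * z) * s) * z := by ring
    rw [h2] at this
    exact pos_of_mul_pos_left this hz.1.le
  intro x b hxb hb hlt
  rcases pos_and_pos_or_neg_and_neg_of_mul_pos hxb with ⟨hx, hb0⟩ | ⟨hx, hb0⟩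
  · rw [abs_of_pos hb0] at hb hlt
    rw [abs_of_pos hx] at hlt
    simpa using main 1 (by norm_num) ⟨hx, hlt.trans hb⟩ ⟨hb0, hb⟩ hlt
  · rw [abs_of_neg hb0] at hb hlt
    rw [abs_of_neg hx] at hlt
    simpa using main (-1) (by norm_num) ⟨by linarith, hlt.trans hb⟩ ⟨by linarith, hb⟩ hlt

theorem GrowsOnSides.eq_of_eq (h : GrowsOnSides σ g ε) {x b : ℝ} (hxb : 0 < x * b) (hx : |x| < ε)
    (hb : |b| < ε) (heq : g x = g b) : x = b := by
  rcases lt_trichotomy |x| |b| with hlt | hlt | hlt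
  · exact absurd (h x b hxb hb hlt) (by rw [heq]; exact lt_irrefl _)
  · rcases abs_eq_abs.1 hlt with h1 | h1
    · exact h1
    · rw [h1] at hxb
      nlinarith [mul_self_nonneg b]
  · exact absurd (h b x (by rwa [mul_comm]) hx hlt) (by rw [heq]; exact lt_irrefl _)

/-- The even power multiplies the height by about `2^(n+1) ≥ 4`, which absorbs relative errors of
one half on both sides. This supplies the barrier for arcs. -/
theorem eventually_lt_neg_two_mul (hn : Odd n) (hB : 0 < σ * B)
    (hg : Tendsto (fun x => g x / x ^ (n + 1)) (𝓝[≠] 0) (𝓝 B)) :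
    ∀ᶠ x in 𝓝[≠] (0 : ℝ), 0 < σ * g x ∧ σ * g x < σ * g (-2 * x) := by
  have h1 := hg.const_mul σ
  have h2 : Tendsto (fun x : ℝ => -2 * x) (𝓝[≠] 0) (𝓝[≠] 0) := by
    refine tendsto_nhdsWithin_iff.2 ⟨?_, ?_⟩
    · exact ((by fun_prop : Continuous fun x : ℝ => -2 * x).tendsto' 0 0 (by simp)).mono_left
        nhdsWithin_le_nhds
    · filter_upwards [self_mem_nhdsWithin] with x hx
      exact mul_ne_zero (by norm_num) hx
  filter_upwards [h1.eventually_const_lt hB, h1.eventually_lt_const (u := 3 / 2 * (σ * B))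
    (by linarith), (h1.comp h2).eventually_const_lt (u := 1 / 2 * (σ * B)) (by linarith),
    self_mem_nhdsWithin] with x hpos hlt hgt hx0
  have hx0 : x ≠ 0 := hx0
  have hP : 0 < x ^ (n + 1) := hn.add_one.pow_pos hx0
  have h4 : (4 : ℝ) ≤ 2 ^ (n + 1) := by
    have := pow_le_pow_right₀ (one_le_two : (1 : ℝ) ≤ 2) (by have := hn.pos; omega : 2 ≤ n + 1)
    linarith
  have h5 : (-2 * x) ^ (n + 1) = 2 ^ (n + 1) * x ^ (n + 1) := by
    rw [neg_mul, hn.add_one.neg_pow, mul_pow]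
  simp only [Function.comp_apply, h5] at hgt
  rw [← mul_div_assoc, lt_div_iff₀ (by positivity)] at hgt
  rw [← mul_div_assoc] at hpos hlt
  rw [div_lt_iff₀ hP] at hlt
  rw [lt_div_iff₀ hP, zero_mul] at hpos
  refine ⟨hpos, hlt.trans_le (le_trans ?_ hgt.le)⟩
  have : 4 * x ^ (n + 1) ≤ 2 ^ (n + 1) * x ^ (n + 1) := by gcongr
  nlinarith [mul_le_mul_of_nonneg_left this hB.le, mul_pos hB hP]

theorem tendsto_div_neg_one (hB : B ≠ 0)
    (hg : Tendsto (fun x => g x / x ^ (n + 1)) (𝓝[≠] 0) (𝓝 B))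
    (hφ0 : Tendsto φ (𝓝[≠] 0) (𝓝[≠] 0))
    (hφ : ∀ᶠ x in 𝓝[≠] (0 : ℝ), φ x * x < 0 ∧ g (φ x) = g x) :
    Tendsto (fun x => φ x / x) (𝓝[≠] 0) (𝓝 (-1)) := by
  have h1 : Tendsto (fun x => (φ x / x) ^ (n + 1)) (𝓝[≠] 0) (𝓝 1) := by
    have := hg.div (hg.comp hφ0) hB
    rw [div_self hB] at this
    refine this.congr' ?_
    filter_upwards [hφ, (hg.eventually_ne hB)] with x hx hgx
    have hx0 : x ≠ 0 := right_ne_zero_of_mul hx.1.ne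
    have hφx : φ x ≠ 0 := left_ne_zero_of_mul hx.1.ne
    have hgx' : g x ≠ 0 := fun h => hgx (by simp [h])
    simp only [Pi.div_apply, Function.comp_apply, hx.2, div_pow]
    field_simp
  have h2 : Tendsto (fun x => |φ x / x|) (𝓝[≠] 0) (𝓝 1) := by
    -- Only the modulus survives the `(n+1)`-st root; the sign comes from `φ x * x < 0`.
    have := (h1.abs.rpow_const (p := ((n + 1 : ℕ) : ℝ)⁻¹) (.inr (by positivity)))
    rw [abs_one, Real.one_rpow] at this
    refine this.congr fun x => ?_
    rw [abs_pow, Real.pow_rpow_inv_natCast (abs_nonneg _) (Nat.succ_ne_zero n)]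
  refine h2.neg.congr' ?_
  filter_upwards [hφ] with x hx
  have hneg : φ x / x < 0 := by
    rcases mul_neg_iff.1 hx.1 with ⟨ha, hb⟩ | ⟨ha, hb⟩
    · exact div_neg_of_pos_of_neg ha hb
    · exact div_neg_of_neg_of_pos ha hb
  rw [abs_of_neg hneg, neg_neg]

/-- A function that is implicitly defined by `g ∘ φ = g` and reverses the sides is continuous. -/
theorem GrowsOnSides.continuousAt (h : GrowsOnSides σ g ε) {x : ℝ} (hgx : ContinuousAt g x)
    (hφε : |φ x| < ε) (hφ : ∀ᶠ y in 𝓝 x, φ y * y < 0 ∧ |φ y| < ε ∧ g (φ y) = g y) :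
    ContinuousAt φ x := by
  obtain ⟨hx, -, hgφ⟩ := hφ.self_of_nhds
  have hx0 : x ≠ 0 := right_ne_zero_of_mul hx.ne
  have hb0 : φ x ≠ 0 := left_ne_zero_of_mul hx.ne
  set s := φ x / |φ x| with hs
  have habs : 0 < |φ x| := abs_pos.2 hb0
  have hsφ : s * |φ x| = φ x := div_mul_cancel₀ _ habs.ne'
  have hs1 : |s| = 1 := by rw [hs, abs_div, abs_abs, div_self habs.ne']
  have hss : s * s = 1 := by rw [← abs_mul_abs_self, hs1, one_mul]
  -- The sign of `φ` is locally constant, so continuity of `|φ|` is enough.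
  have hside : ∀ᶠ y in 𝓝 x, φ y = s * |φ y| := by
    have hyx : ∀ᶠ y in 𝓝 x, 0 < y * x :=
      (continuousAt_id.mul continuousAt_const).eventually_const_lt (mul_self_pos.2 hx0)
    filter_upwards [hφ, hyx] with y hy hyx
    have h1 : 0 < φ y * s := by
      have : 0 < (φ y * s) * (|φ x| * ((y * x) * x ^ 2)) := by
        have : 0 < (φ y * y) * (φ x * x) * x ^ 2 :=
          mul_pos (mul_pos_of_neg_of_neg hy.1 hx) (by positivity)
        rw [← hsφ] at this
        linarith
      exact pos_of_mul_pos_left this (by positivity)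
    have h2 : |φ y| = φ y * s := by
      rw [← abs_of_pos h1, abs_mul, hs1, mul_one]
    rw [h2]
    linear_combination -φ y * hss
  have hlim : Tendsto (fun y => |φ y|) (𝓝 x) (𝓝 |φ x|) := by
    have hcont : ContinuousAt (fun y => σ * g y) x := continuousAt_const.mul hgx
    have hprod : ∀ a b : ℝ, 0 < a → 0 < b → 0 < (s * a) * (s * b) := fun a b ha hb => by
      have : (s * a) * (s * b) = (s * s) * (a * b) := by ring
      rw [this, hss, one_mul]
      exact mul_pos ha hb
    have hsabs : ∀ a, 0 < a → |s * a| = a := fun a ha => by rw [abs_mul, hs1, one_mul, abs_of_pos ha]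
    refine tendsto_order.2 ⟨fun a ha => ?_, fun a ha => ?_⟩
    · rcases le_or_gt a 0 with ha0 | ha0
      · filter_upwards [hφ] with y hy
        exact ha0.trans_lt (abs_pos.2 (left_ne_zero_of_mul hy.1.ne))
      have h1 : σ * g (s * a) < σ * g x := by
        rw [← hgφ]
        exact h _ _ (by rw [← hsφ]; exact hprod _ _ ha0 habs) hφε (by rwa [hsabs a ha0])
      filter_upwards [hφ, hside, hcont.eventually_const_lt h1] with y hy hys hya
      by_contra! hle
      have hy0 : 0 < |φ y| := abs_pos.2 (left_ne_zero_of_mul hy.1.ne)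
      rcases hle.lt_or_eq with hlt | heq
      · have := h (φ y) (s * a) (by rw [hys]; exact hprod _ _ hy0 ha0)
          (by rw [hsabs a ha0]; exact ha.trans hφε) (by rwa [hsabs a ha0])
        rw [hy.2.2] at this
        exact this.not_gt hya
      · rw [← heq, ← hys, hy.2.2] at hya
        exact lt_irrefl _ hya
    · obtain ⟨a', ha1, ha2⟩ := exists_between (lt_min ha hφε)
      rw [lt_min_iff] at ha2
      have ha0 : 0 < a' := habs.trans ha1
      have h1 : σ * g x < σ * g (s * a') := by
        rw [← hgφ]
        exact h _ _ (by nth_rw 1 [← hsφ]; exact hprod _ _ habs ha0)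
          (by rw [hsabs a' ha0]; exact ha2.2) (by rwa [hsabs a' ha0])
      filter_upwards [hφ, hside, hcont.eventually_lt_const h1] with y hy hys hya
      refine lt_of_lt_of_le ?_ ha2.1.le
      by_contra! hle
      have hy0 : 0 < |φ y| := abs_pos.2 (left_ne_zero_of_mul hy.1.ne)
      rcases hle.lt_or_eq with hlt | heq
      · have := h (s * a') (φ y) (by rw [hys]; exact hprod _ _ ha0 hy0) hy.2.1
          (by rwa [hsabs a' ha0])
        rw [hy.2.2] at this
        exact this.not_gt hya
      · rw [heq, ← hys, hy.2.2] at hya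
        exact lt_irrefl _ hya
  have := hlim.const_mul s
  rw [hsφ] at this
  exact this.congr' (hside.mono fun y hy => hy.symm)

/-- `φ' x = g' x / g' (φ x)` behaves like `(x / φ x)^n`, which tends to `(-1)^n = -1`. -/
theorem exists_deriv_tendsto_neg_one (hn : Odd n) (hB : 0 < σ * B)
    (hg : ∀ᶠ x in 𝓝 (0 : ℝ), HasDerivAt g (g' x) x)
    (hg' : Tendsto (fun x => g' x / x ^ n) (𝓝[≠] 0) (𝓝 B))
    (hφ0 : Tendsto φ (𝓝[≠] 0) (𝓝[≠] 0)) (hlim : Tendsto (fun x => φ x / x) (𝓝[≠] 0) (𝓝 (-1)))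
    (hφ : ∀ᶠ x in 𝓝[≠] (0 : ℝ), φ x * x < 0 ∧ g (φ x) = g x) :
    ∃ φ' : ℝ → ℝ, (∀ᶠ x in 𝓝[≠] (0 : ℝ), HasDerivAt φ (φ' x) x) ∧
      Tendsto φ' (𝓝[≠] 0) (𝓝 (-1)) := by
  have hB0 : B ≠ 0 := right_ne_zero_of_mul hB.ne'
  obtain ⟨ε, hε, hgrow⟩ := exists_growsOnSides hn hB hg hg'
  have hφlim : Tendsto φ (𝓝[≠] 0) (𝓝 0) := hφ0.mono_right nhdsWithin_le_nhds
  have hφε : ∀ᶠ x in 𝓝[≠] (0 : ℝ), |φ x| < ε :=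
    hφlim.abs.eventually_lt_const (by simpa using hε)
  refine ⟨fun x => g' x / g' (φ x), ?_, ?_⟩
  · have hall : ∀ᶠ x in 𝓝[≠] (0 : ℝ), φ x * x < 0 ∧ |φ x| < ε ∧ g (φ x) = g x := by
      filter_upwards [hφ, hφε] with x h1 h2
      exact ⟨h1.1, h2, h1.2⟩
    have hall' : ∀ᶠ x in 𝓝[≠] (0 : ℝ), ∀ᶠ y in 𝓝 x,
        φ y * y < 0 ∧ |φ y| < ε ∧ g (φ y) = g y := by
      filter_upwards [eventually_eventually_nhdsWithin.2 hall, self_mem_nhdsWithin] with x h1 hx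
      rwa [isOpen_compl_singleton.nhdsWithin_eq hx] at h1
    have hne : ∀ᶠ x in 𝓝[≠] (0 : ℝ), g' x ≠ 0 :=
      (eventually_pos_mul hn hB hg').mono fun x hx h0 => by simp [h0] at hx
    filter_upwards [hall', hφε, hφlim.eventually hg, nhdsWithin_le_nhds hg,
      hφ0.eventually hne] with x h1 h2 h3 h4 h5
    refine HasDerivAt.of_comp_left h3 h5 (hgrow.continuousAt h4.continuousAt h2 h1) ?_
    exact h4.congr_of_eventuallyEq (h1.mono fun y hy => hy.2.2)
  · have h1 := ((hg'.div (hg'.comp hφ0) hB0)).div (hlim.pow n)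
      (by rw [hn.neg_one_pow]; norm_num)
    rw [div_self hB0, hn.neg_one_pow] at h1
    norm_num at h1
    refine h1.congr' ?_
    filter_upwards [hφ] with x hx
    have hx0 : x ≠ 0 := right_ne_zero_of_mul hx.1.ne
    have hφx : φ x ≠ 0 := left_ne_zero_of_mul hx.1.ne
    simp only [Pi.div_apply, Function.comp_apply, div_pow]
    field_simp

end Even

/-! ### The center -/

/-- An orbit of `F` joins `(x, 0)` to `(b, 0)` in time `τ`, forwards if `e = 1` and backwards if
`e = -1`, and turns around the origin. -/
structure IsLocalArc (F : ℝ × ℝ → ℝ × ℝ) (Y : ℝ → ℝ → ℝ) (e x b τ : ℝ) : Prop where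
  direction : e * (F 0).1 * x < 0
  abs_le : |b| ≤ 2 * |x|
  mul_neg : b * x < 0
  eq_zero : Y b x = 0
  eq_axis : Y 0 b = Y 0 x
  time : τ = e * (timeToAxis F Y x - timeToAxis F Y b)

variable {F : ℝ × ℝ → ℝ × ℝ} {Y : ℝ → ℝ → ℝ} {K R r : ℝ} {V S : Set (ℝ × ℝ)}

/-- This turns trajectories into identities between functions of the end points. It covers all `b`
and `τ` at once, because the intermediate point of a first return is not known in advance. -/
theorem IsGraphFlow.eventually_isLocalArc (h : IsGraphFlow F Y K R r) {n : ℕ} (hn : Odd n)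
    {σ B : ℝ} (hB : 0 < σ * B)
    (hg' : Tendsto (fun x => initialDeriv F Y 0 x / x ^ n) (𝓝[≠] 0) (𝓝 B))
    (hg : Tendsto (fun x => Y 0 x / x ^ (n + 1)) (𝓝[≠] 0) (𝓝 (B / (n + 1))))
    (hS : ∀ p ∈ S, 0 < σ * p.2) :
    ∀ᶠ x in 𝓝[≠] (0 : ℝ), ∀ b τ, (IsArc F S x b τ → IsLocalArc F Y 1 x b τ) ∧
      (IsArc F S b x τ → IsLocalArc F Y (-1) x b τ) := by
  have hgd : ∀ᶠ x in 𝓝 (0 : ℝ), HasDerivAt (fun x => Y 0 x) (initialDeriv F Y 0 x) x :=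
    h.eventually_abs_lt.mono fun x hx => h.hasDerivAt_initial hx h.abs_zero_lt
  have hB' : 0 < σ * (B / (n + 1)) := by
    rw [← mul_div_assoc]; positivity
  obtain ⟨ε, hε, hgrow⟩ := exists_growsOnSides hn hB hgd hg'
  have hsmall : ∀ᶠ x in 𝓝 (0 : ℝ), 2 * |x| < min r ε :=
    (by fun_prop : Continuous fun x : ℝ => 2 * |x|).continuousAt.eventually_lt_const
      (by simpa using ⟨h.pos, hε⟩)
  filter_upwards [nhdsWithin_le_nhds hsmall, eventually_pos_mul hn hB hg',
    eventually_lt_neg_two_mul hn hB' hg] with x hx hpos hord b τ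
  rw [lt_min_iff] at hx
  have hxr : |x| < r := by linarith [abs_nonneg x]
  have hslope : σ * orbitSlope F (x, 0) * x < 0 := by
    have h1 : σ * initialDeriv F Y 0 x * x =
        -(σ * orbitSlope F (x, 0) * x) * Real.exp (logSeparation F Y 0 x) := by
      rw [initialDeriv]; ring
    rw [h1] at hpos
    linarith [pos_of_mul_pos_left hpos (Real.exp_pos _).le]
  have main : ∀ (e : ℝ) (p q : ℝ → ℝ), e * e = 1 → 0 < τ → p 0 = x → q 0 = 0 → p τ = b → q τ = 0 →
      (∀ t ∈ Ioo 0 τ, 0 < σ * q t) →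
      (∀ t ∈ Icc 0 τ, HasDerivWithinAt p (e * (F (p t, q t)).1) (Icc 0 τ) t) →
      (∀ t ∈ Icc 0 τ, HasDerivWithinAt q (e * (F (p t, q t)).2) (Icc 0 τ) t) →
      IsLocalArc F Y e x b τ := by
    intro e p q he hτ hp0 hq0 hpτ hqτ hq hpd hqd
    obtain ⟨h1, h2, h3, h4, h5⟩ :=
      h.arc_endpoint he hx.1 hslope hord.2 hτ hp0 hq0 hpτ hqτ hq hpd hqd
    have hbr : |b| < r := h2.trans_lt hx.1
    have heq : Y 0 b = Y 0 x := h.eq_of_zero hxr hbr h.abs_zero_lt h4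
    refine ⟨h1, h2, ?_, h4, heq, by rw [h5, h.integral_slowness_eq hxr hbr h4]⟩
    -- An end point on the same side would equal `x`, since heights grow there; the end point `0`
    -- would give `x` height `0`.
    by_contra! hcon
    rcases hcon.lt_or_eq with hlt | h0
    · exact h3 (hgrow.eq_of_eq hlt (h2.trans_lt hx.2) (by linarith [abs_nonneg x]) heq)
    · have hb0 : b = 0 := (mul_eq_zero.1 h0.symm).resolve_right (right_ne_zero_of_mul h1.ne)
      rw [hb0, h.start 0 h.abs_zero_lt] at heq
      simp [← heq] at hord
  have hfst : ∀ {γ : ℝ → ℝ × ℝ} {v t I}, HasDerivWithinAt γ v I t →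
      HasDerivWithinAt (fun t => (γ t).1) v.1 I t := fun {γ v t I} h =>
    (hasFDerivAt_fst (p := γ t)).comp_hasDerivWithinAt t h
  have hsnd : ∀ {γ : ℝ → ℝ × ℝ} {v t I}, HasDerivWithinAt γ v I t →
      HasDerivWithinAt (fun t => (γ t).2) v.2 I t := fun {γ v t I} h =>
    (hasFDerivAt_snd (p := γ t)).comp_hasDerivWithinAt t h
  refine ⟨fun ⟨hτ, γ, h0, h1, hγS, hγ⟩ => ?_, fun ⟨hτ, γ, h0, h1, hγS, hγ⟩ => ?_⟩
  · refine main 1 (fun t => (γ t).1) (fun t => (γ t).2) (by norm_num) hτ (by simp [h0])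
      (by simp [h0]) (by simp [h1]) (by simp [h1]) (fun t ht => hS _ (hγS t ht))
      (fun t ht => ?_) (fun t ht => ?_)
    · simpa using hfst (hγ t ht)
    · simpa using hsnd (hγ t ht)
  -- An arc arriving at `x` is run backwards, as a trajectory of `-F`.
  · have hrev : ∀ t ∈ Icc 0 τ, HasDerivWithinAt (fun t => γ (τ - t)) (-F (γ (τ - t))) (Icc 0 τ) t :=
      fun t ht => by
        have hm : MapsTo (fun t => τ - t) (Icc 0 τ) (Icc 0 τ) := fun u hu =>
          ⟨by linarith [hu.2], by linarith [hu.1]⟩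
        have := (hγ (τ - t) (hm ht)).scomp t
          (((hasDerivAt_id' t).const_sub τ).hasDerivWithinAt (s := Icc 0 τ)) hm
        simpa [Function.comp_def] using this
    refine main (-1) (fun t => (γ (τ - t)).1) (fun t => (γ (τ - t)).2) (by norm_num) hτ
      (by simp [h1]) (by simp [h1]) (by simp [h0]) (by simp [h0])
      (fun t ht => hS _ (hγS _ ⟨by linarith [ht.2], by linarith [ht.1]⟩))
      (fun t ht => ?_) (fun t ht => ?_)
    · simpa using hfst (hrev t ht)
    · simpa using hsnd (hrev t ht)

theorem halfPeriod_eq_integral (F : ℝ × ℝ → ℝ × ℝ) (c : ℝ) (φ : ℝ → ℝ) (y : ℝ → ℝ → ℝ) (x : ℝ) :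
    halfPeriod F c φ y x = ∫ u in x..φ x, slowness F (u, y (c * (u - x)) x) := by
  have := intervalIntegral.mul_integral_comp_add_mul (a := 0) (b := 1)
    (f := fun u => slowness F (u, y (c * (u - x)) x)) (φ x - x) x
  simp only [mul_zero, add_zero, mul_one, add_sub_cancel] at this
  rw [← this, halfPeriod]
  congr 2
  ext t
  rw [slowness]
  congr 5
  ring

theorem IsGraphFlow.hasDerivAt_timeToAxis_zero (h : IsGraphFlow F Y K R r) :
    HasDerivAt (timeToAxis F Y) (-slowness F 0) 0 := by
  refine (h.hasDerivAt_timeToAxis h.abs_zero_lt).congr_deriv ?_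
  rw [timeToAxisDeriv, intervalIntegral.integral_same, add_zero]
  rfl

/-- The derivative of a signed half-period along a map `φ` that is tangent to `x ↦ -x`. -/
theorem IsGraphFlow.exists_deriv_timeToAxis_sub (h : IsGraphFlow F Y K R r) {φ φ' : ℝ → ℝ}
    (hφ0 : Tendsto φ (𝓝[≠] 0) (𝓝 0)) (hφ : ∀ᶠ x in 𝓝[≠] (0 : ℝ), HasDerivAt φ (φ' x) x)
    (hφ' : Tendsto φ' (𝓝[≠] 0) (𝓝 (-1))) :
    ∃ D : ℝ → ℝ,
      (∀ᶠ x in 𝓝[≠] (0 : ℝ),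
        HasDerivAt (fun x => timeToAxis F Y x - timeToAxis F Y (φ x)) (D x) x) ∧
      Tendsto D (𝓝[≠] 0) (𝓝 (-2 * slowness F 0)) := by
  refine ⟨fun x => timeToAxisDeriv F Y x - timeToAxisDeriv F Y (φ x) * φ' x, ?_, ?_⟩
  · filter_upwards [hφ, hφ0.eventually h.eventually_abs_lt,
      nhdsWithin_le_nhds h.eventually_abs_lt] with x h1 h2 h3
    exact (h.hasDerivAt_timeToAxis h3).sub ((h.hasDerivAt_timeToAxis h2).comp x h1)
  · have := (h.tendsto_timeToAxisDeriv.mono_left nhdsWithin_le_nhds).sub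
      ((h.tendsto_timeToAxisDeriv.comp hφ0).mul hφ')
    have e : -slowness F 0 - -slowness F 0 * -1 = -2 * slowness F 0 := by ring
    rwa [e] at this

theorem IsGraphFlow.hasDerivAt_timeToAxis_sub_zero (h : IsGraphFlow F Y K R r) {φ : ℝ → ℝ}
    (h0 : φ 0 = 0) (hφ : HasDerivAt φ (-1) 0) :
    HasDerivAt (fun x => timeToAxis F Y x - timeToAxis F Y (φ x)) (-2 * slowness F 0) 0 := by
  have h1 : HasDerivAt (timeToAxis F Y) (-slowness F 0) (φ 0) := by
    rw [h0]; exact h.hasDerivAt_timeToAxis_zero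
  refine (h.hasDerivAt_timeToAxis_zero.sub (h1.comp 0 hφ)).congr_deriv ?_
  ring

theorem delta_mul_self {Z : ℝ × ℝ → ℝ × ℝ} (hZ : (Z 0).1 ≠ 0) : delta Z * delta Z = 1 := by
  rcases lt_or_gt_of_ne hZ with h | h
  · rw [delta, show ((0 : ℝ), (0 : ℝ)) = 0 from rfl, Real.sign_of_neg h]; norm_num
  · rw [delta, show ((0 : ℝ), (0 : ℝ)) = 0 from rfl, Real.sign_of_pos h]; norm_num

/-- The two pieces of a first return that closes up. -/
theorem exists_local_arcs {Zp Zm : ℝ × ℝ → ℝ × ℝ} {Yp Ym : ℝ → ℝ → ℝ} {x b τ₁ τ₂ : ℝ}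
    {Up Um : Set (ℝ × ℝ)}
    (hp : ∀ b τ, (IsArc Zp Up x b τ → IsLocalArc Zp Yp 1 x b τ) ∧
      (IsArc Zp Up b x τ → IsLocalArc Zp Yp (-1) x b τ))
    (hm : ∀ b τ, (IsArc Zm Um x b τ → IsLocalArc Zm Ym 1 x b τ) ∧
      (IsArc Zm Um b x τ → IsLocalArc Zm Ym (-1) x b τ))
    (h : (IsArc Zp Up x b τ₁ ∧ IsArc Zm Um b x τ₂) ∨ (IsArc Zm Um x b τ₁ ∧ IsArc Zp Up b x τ₂)) :
    ∃ e τp τm, e * e = 1 ∧ IsLocalArc Zp Yp e x b τp ∧ IsLocalArc Zm Ym (-e) x b τm ∧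
      τ₁ + τ₂ = τp + τm := by
  rcases h with ⟨h1, h2⟩ | ⟨h1, h2⟩
  · exact ⟨1, τ₁, τ₂, by norm_num, (hp b τ₁).1 h1, (hm b τ₂).2 h2, rfl⟩
  · exact ⟨-1, τ₂, τ₁, by norm_num, (hp b τ₂).2 h2, by simpa using (hm b τ₁).1 h1, add_comm _ _⟩

theorem exists_half_flow {σ : ℝ} {c : ℝ} {y : ℝ → ℝ → ℝ} {k : ℕ} (hV : IsOpen V) (h0 : 0 ∈ V)
    (hF : ContDiffOn ℝ ∞ F V) (hc : IsContact F Prod.snd 0 (2 * k))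
    (hσ : σ * lieIter F Prod.snd (2 * k) 0 < 0) (hcc : (F 0).1 ≠ 0 → c * c = 1)
    (hy : IsIVPSolution F V c y) (hS : ∀ p ∈ S, 0 < σ * p.2) :
    ∃ (Y : ℝ → ℝ → ℝ) (K R r B : ℝ) (n : ℕ), Y = (fun s x => y (c * (s - x)) x) ∧
      IsGraphFlow F Y K R r ∧ (F 0).1 ≠ 0 ∧ Odd n ∧ 0 < σ * B ∧
      Tendsto (fun x => initialDeriv F Y 0 x / x ^ n) (𝓝[≠] 0) (𝓝 B) ∧
      Tendsto (fun x => Y 0 x / x ^ (n + 1)) (𝓝[≠] 0) (𝓝 (B / (n + 1))) ∧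
      ∀ᶠ x in 𝓝[≠] (0 : ℝ), ∀ b τ, (IsArc F S x b τ → IsLocalArc F Y 1 x b τ) ∧
        (IsArc F S b x τ → IsLocalArc F Y (-1) x b τ) := by
  -- Multiplicity `0` would require `h` to be both zero and nonzero at the origin.
  obtain _ | k := k
  · exact absurd hc.1 hc.2.2
  have hn : Odd (2 * k + 1) := ⟨k, rfl⟩
  have hX := IsContact.fst_ne_zero (k := 2 * k + 1) hc (by omega)
  obtain ⟨K, R, r, h⟩ := exists_isGraphFlow
    ((hF.contDiffAt (hV.mem_nhds h0)).of_le ENat.LEInfty.out) hX (hcc hX) hy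
  obtain ⟨B, hB, hg', hg⟩ := h.exists_contact_asymptotics hV h0 hF hn hc hσ
  exact ⟨_, K, R, r, B, 2 * k + 1, rfl, h, hX, hn, hB, hg', hg,
    h.eventually_isLocalArc hn hB hg' hg hS⟩

theorem delta_of_mul_neg {Z : ℝ × ℝ → ℝ × ℝ} {e x : ℝ} (he : e * e = 1) (hx : 0 < x)
    (h : e * (Z 0).1 * x < 0) : delta Z = -e := by
  rw [delta, show ((0 : ℝ), (0 : ℝ)) = 0 from rfl]
  have h1 : e * (Z 0).1 < 0 := neg_of_mul_neg_left h hx.le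
  rcases mul_self_eq_one_iff.1 he with rfl | rfl
  · exact Real.sign_of_neg (by linarith)
  · rw [Real.sign_of_pos (by linarith), neg_neg]

theorem sub_div_mul_eq_slowness {Zp Zm : ℝ × ℝ → ℝ × ℝ} (hp : (Zp 0).1 ≠ 0) (hm : (Zm 0).1 ≠ 0) :
    2 * delta Zp * (((Zm (0, 0)).1 - (Zp (0, 0)).1) / ((Zp (0, 0)).1 * (Zm (0, 0)).1)) =
      delta Zp * (-2 * slowness Zm 0 - -2 * slowness Zp 0) := by
  rw [show ((0 : ℝ), (0 : ℝ)) = 0 from rfl, slowness, slowness]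
  field_simp
  ring

theorem slope_period_pos {Zp Zm : ℝ × ℝ → ℝ × ℝ} (h : (Zp 0).1 * (Zm 0).1 < 0) :
    0 < 2 * delta Zp *
      (((Zm (0, 0)).1 - (Zp (0, 0)).1) / ((Zp (0, 0)).1 * (Zm (0, 0)).1)) := by
  rw [delta, show ((0 : ℝ), (0 : ℝ)) = 0 from rfl]
  rcases mul_neg_iff.1 h with ⟨h1, h2⟩ | ⟨h1, h2⟩
  · rw [Real.sign_of_pos h1]
    exact mul_pos (by norm_num) (div_pos_of_neg_of_neg (by linarith) h)
  · rw [Real.sign_of_neg h1]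
    exact mul_pos_of_neg_of_neg (by norm_num) (div_neg_of_pos_of_neg (by linarith) h)

theorem hasDerivAt_zero_of_tendsto_div {φ : ℝ → ℝ} {d : ℝ} (h0 : φ 0 = 0)
    (h : Tendsto (fun x => φ x / x) (𝓝[≠] 0) (𝓝 d)) : HasDerivAt φ d 0 := by
  rw [hasDerivAt_iff_tendsto_slope]
  refine h.congr fun x => ?_
  rw [slope_def_field, h0, sub_zero, sub_zero]

end Filippov

end

/-! ### The period function of the center -/

open Filippov in
theorem mainTheorem3
    (V : Set (ℝ × ℝ)) (hV : IsOpen V) (h0 : ((0, 0) : ℝ × ℝ) ∈ V)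
    (Zp Zm : ℝ × ℝ → ℝ × ℝ) (hZp : ContDiffOn ℝ ∞ Zp V) (hZm : ContDiffOn ℝ ∞ Zm V)
    (kp km : ℕ) (hc : Filippov.IsTangentialCenter Zp Zm V kp km)
    (φ : ℝ → ℝ) (hφ : Filippov.IsHalfReturnMap Zp (Filippov.upper V) φ)
    (yp ym : ℝ → ℝ → ℝ)
    (hyp : Filippov.IsIVPSolution Zp V (Filippov.delta Zp) yp)
    (hym : Filippov.IsIVPSolution Zm V (-Filippov.delta Zp) ym)
    (T : ℝ → ℝ) (hT : T = Filippov.periodFunction Zp Zm φ yp ym) :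
    T 0 = 0 ∧
    HasDerivAt T
      (2 * Filippov.delta Zp *
        (((Zm (0, 0)).1 - (Zp (0, 0)).1) / ((Zp (0, 0)).1 * (Zm (0, 0)).1))) 0 ∧
    0 < 2 * Filippov.delta Zp *
        (((Zm (0, 0)).1 - (Zp (0, 0)).1) / ((Zp (0, 0)).1 * (Zm (0, 0)).1)) ∧
    ∃ ε > 0, ∀ x ∈ Ioo 0 ε,
      Filippov.IsFirstReturn Zp Zm V x x (T x) ∧
      DifferentiableAt ℝ T x ∧ ¬ Filippov.IsCriticalPeriod T x := by
  obtain ⟨Yp, Kp, Rp, rp, B, n, hYp, hp, hXp, hn, hB, hgp', hgp, harcp⟩ :=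
    exists_half_flow (S := upper V) (σ := 1) hV h0 hZp hc.contact_plus
      (by rw [one_mul]; exact hc.invisible_plus) delta_mul_self hyp
      (fun p hp => by rw [one_mul]; exact hp.2)
  have hδ := delta_mul_self hXp
  obtain ⟨Ym, Km, Rm, rm, -, -, hYm, hm, hXm, -, -, -, -, harcm⟩ :=
    exists_half_flow (S := lower V) (σ := -1) hV h0 hZm hc.contact_minus
      (by rw [neg_one_mul]; exact neg_neg_of_pos hc.invisible_minus)
      (fun _ => by rw [neg_mul_neg, hδ]) hym
      (fun p hp => by rw [neg_one_mul]; exact neg_pos.2 hp.2)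
  have hgd : ∀ᶠ x in 𝓝 (0 : ℝ), HasDerivAt (fun x => Yp 0 x) (initialDeriv Zp Yp 0 x) x :=
    hp.eventually_abs_lt.mono fun x hx => hp.hasDerivAt_initial hx hp.abs_zero_lt
  obtain ⟨ε, hε, hgrow⟩ := exists_growsOnSides hn hB hgd hgp'
  have hεev : ∀ᶠ x in 𝓝[≠] (0 : ℝ), 2 * |x| < ε :=
    nhdsWithin_le_nhds <| (by fun_prop : Continuous fun x : ℝ => 2 * |x|).continuousAt
      |>.eventually_lt_const (by simpa using hε)
  have hφp : ∀ᶠ x in 𝓝[≠] (0 : ℝ), ∃ e τ, IsLocalArc Zp Yp e x (φ x) τ := by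
    filter_upwards [hφ.2, harcp] with x ⟨τ, hτ⟩ h
    rcases hτ with hτ | hτ
    · exact ⟨1, τ, (h _ τ).1 hτ⟩
    · exact ⟨-1, τ, (h _ τ).2 hτ⟩
  have hret : ∀ᶠ x in 𝓝[≠] (0 : ℝ), ∃ e τp τm, e * e = 1 ∧ IsLocalArc Zp Yp e x (φ x) τp ∧
      IsLocalArc Zm Ym (-e) x (φ x) τm ∧ IsFirstReturn Zp Zm V x x (τp + τm) := by
    filter_upwards [hφp, hεev, harcp, harcm, hc.return_map, hc.return_eq]
      with x ⟨e', τ', hx⟩ hxε h1 h2 ⟨x', t, ht⟩ h3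
    obtain rfl := h3 x' t ht
    obtain ⟨b, τ₁, τ₂, rfl, hb⟩ := ht
    obtain ⟨e, τp, τm, he, hap, ham, hsum⟩ := exists_local_arcs h1 h2 hb
    -- The crossing point `b` and `φ x'` both lie opposite to `x'` and have equal height, hence
    -- coincide; so the `Z⁻` arc also joins `x'` to `φ x'`.
    have hside : 0 < φ x' * b := by
      have h4 : 0 < (φ x' * b) * (x' * x') := by
        have := mul_pos_of_neg_of_neg hx.mul_neg hap.mul_neg
        linarith
      exact pos_of_mul_pos_left h4 (mul_self_nonneg _)
    have hbφ : φ x' = b := hgrow.eq_of_eq hside (hx.abs_le.trans_lt hxε) (hap.abs_le.trans_lt hxε)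
      (hx.eq_axis.trans hap.eq_axis.symm)
    rw [hbφ]
    exact ⟨e, τp, τm, he, hap, ham, b, τ₁, τ₂, hsum.symm, hb⟩
  -- One tour runs the two arcs between `x` and `φ x` in opposite directions.
  have hopp : (Zp 0).1 * (Zm 0).1 < 0 := by
    obtain ⟨x, e, τp, τm, he, hap, ham, -⟩ := hret.exists
    have h1 := mul_pos_of_neg_of_neg hap.direction ham.direction
    have h2 : e * (Zp 0).1 * x * (-e * (Zm 0).1 * x) =
        -((Zp 0).1 * (Zm 0).1) * (x * x) * (e * e) := by ring
    rw [h2, he, mul_one] at h1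
    linarith [pos_of_mul_pos_left h1 (mul_self_nonneg x)]
  have hφlim : Tendsto φ (𝓝[≠] 0) (𝓝[≠] 0) := by
    refine tendsto_nhdsWithin_iff.2 ⟨squeeze_zero_norm' (a := fun x => 2 * |x|) ?_ ?_, ?_⟩
    · exact hφp.mono fun x ⟨_, _, hx⟩ => hx.abs_le
    · exact ((by fun_prop : Continuous fun x : ℝ => 2 * |x|).tendsto' 0 0 (by simp)).mono_left
        nhdsWithin_le_nhds
    · exact hφp.mono fun x ⟨_, _, hx⟩ => left_ne_zero_of_mul hx.mul_neg.ne
  have hφ0 : Tendsto φ (𝓝[≠] 0) (𝓝 0) := hφlim.mono_right nhdsWithin_le_nhds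
  have hφg : ∀ᶠ x in 𝓝[≠] (0 : ℝ), φ x * x < 0 ∧ Yp 0 (φ x) = Yp 0 x :=
    hφp.mono fun x ⟨_, _, hx⟩ => ⟨hx.mul_neg, hx.eq_axis⟩
  have hdiv := tendsto_div_neg_one (g := fun x => Yp 0 x)
    (div_ne_zero (right_ne_zero_of_mul hB.ne') (by positivity)) hgp hφlim hφg
  obtain ⟨φ', hφd, hφ'⟩ := exists_deriv_tendsto_neg_one hn hB hgd hgp' hφlim hdiv hφg
  have hφd0 := hasDerivAt_zero_of_tendsto_div hφ.1 hdiv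
  obtain ⟨Dp, hDp, hDplim⟩ := hp.exists_deriv_timeToAxis_sub hφ0 hφd hφ'
  obtain ⟨Dm, hDm, hDmlim⟩ := hm.exists_deriv_timeToAxis_sub hφ0 hφd hφ'
  have hT0 : T 0 = 0 := by
    simp [hT, periodFunction, halfPeriod, hφ.1]
  have hTeq : ∀ᶠ x in 𝓝[≠] (0 : ℝ), T x = delta Zp *
      ((timeToAxis Zm Ym x - timeToAxis Zm Ym (φ x)) -
        (timeToAxis Zp Yp x - timeToAxis Zp Yp (φ x))) := by
    filter_upwards [hret, hφ0.eventually hp.eventually_abs_lt, hφ0.eventually hm.eventually_abs_lt,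
      nhdsWithin_le_nhds hp.eventually_abs_lt, nhdsWithin_le_nhds hm.eventually_abs_lt]
      with x ⟨e, τp, τm, he, hap, ham, _⟩ h1 h2 h3 h4
    rw [← hp.integral_slowness_eq h3 h1 hap.eq_zero, ← hm.integral_slowness_eq h4 h2 ham.eq_zero,
      hT, periodFunction, halfPeriod_eq_integral, halfPeriod_eq_integral, hYp, hYm]
  have hTeq0 : T =ᶠ[𝓝 0] fun x => delta Zp *
      ((timeToAxis Zm Ym x - timeToAxis Zm Ym (φ x)) -
        (timeToAxis Zp Yp x - timeToAxis Zp Yp (φ x))) := by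
    rw [eventually_nhdsWithin_iff] at hTeq
    filter_upwards [hTeq] with x hx
    rcases eq_or_ne x 0 with rfl | hne
    · simp [hT0, hφ.1]
    · exact hx hne
  have hpos := slope_period_pos hopp
  refine ⟨hT0, ?_, hpos, ?_⟩
  · rw [sub_div_mul_eq_slowness hXp hXm]
    exact (((hm.hasDerivAt_timeToAxis_sub_zero hφ.1 hφd0).sub
      (hp.hasDerivAt_timeToAxis_sub_zero hφ.1 hφd0)).const_mul (delta Zp)).congr_of_eventuallyEq
      hTeq0
  -- The derivatives of `T` tend to the positive number `T' 0`, so they are eventually positive.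
  · have hlim := (hDmlim.sub hDplim).const_mul (delta Zp)
    rw [← sub_div_mul_eq_slowness hXp hXm] at hlim
    have hTd : ∀ᶠ x in 𝓝[≠] (0 : ℝ), HasDerivAt T (delta Zp * (Dm x - Dp x)) x := by
      filter_upwards [eventually_eventually_nhdsWithin.2 hTeq, hDp, hDm, self_mem_nhdsWithin]
        with x h1 h2 h3 hx
      rw [isOpen_compl_singleton.nhdsWithin_eq hx] at h1
      exact ((h3.sub h2).const_mul (delta Zp)).congr_of_eventuallyEq h1
    have hall : ∀ᶠ x in 𝓝[>] (0 : ℝ), IsFirstReturn Zp Zm V x x (T x) ∧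
        DifferentiableAt ℝ T x ∧ ¬ IsCriticalPeriod T x := by
      have hle : 𝓝[>] (0 : ℝ) ≤ 𝓝[≠] 0 := nhdsWithin_mono 0 fun x (hx : 0 < x) => hx.ne'
      filter_upwards [hle hret, hle hTeq, hle hTd, hle (hlim.eventually_const_lt hpos),
        self_mem_nhdsWithin] with x ⟨e, τp, τm, he, hap, ham, hfr⟩ hTx hd hne hx
      refine ⟨?_, hd.differentiableAt, fun h => hne.ne' ?_⟩
      -- For `x > 0` the direction of the arcs gives `δ = -e`, so the signed half-periods add up to
      -- the two durations.
      · have htime : T x = τp + τm := by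
          rw [hTx, delta_of_mul_neg he hx hap.direction, hap.time, ham.time]
          ring
        rwa [htime]
      · rw [← hd.deriv]
        exact h.2
    obtain ⟨η, hη, hsub⟩ := mem_nhdsGT_iff_exists_Ioo_subset.1 hall
    exact ⟨η, hη, fun x hx => hsub hx⟩
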